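/- Let $F$ be a ccc $P$-filter on $\omega$: a proper filter containing all cofinite sets, such that for all $A_n\in F$ $(n<\omega)$ there is $B\in F$ with $B\setminus A_n$ finite for every $n$, and such that every antichain of $\mathcal P(\omega)/F$ is countable. Let $I=\{\omega\setminus A: A\in F\}$ be the dual ideal. A tree is a partial order $(T,\le_T)$ with $T\subseteq\omega$ in which the predecessors of each element are linearly ordered and $i\le_T j$ implies $i\le j$; a branch is a maximal chain. Write $T\le_t S$ if $(S,\le_S)$ is a suborder of $(T,\le_T)$ and each branch of $T$ contains cofinally a unique branch of $S$. Let $T^{(n)}$ denote $T$ with all numbers $\le n$ deleted. There is a tree $T_0\in I$ which is order isomorphic to the full binary tree $2^{<\omega}$. Fix any such $T_0$. Let $\mathbf P(F)$ be the forcing of all pairs $p=\langle T_p,f_p\rangle$, where $T_p\in I$ is a tree with $T_p\le_t T_0^{(n)}$ for some $n$ and $f_p:T_p\to\{0,1\}$, ordered by $p\le q$ iff $T_p\le_t T_q$ and $f_p\supseteq f_q$. Let $\mathbf Q=\mathbf Q(F)$ be the full product of countably many copies $(i<\omega)$ of $\mathbf P(F)$, ordered coordinatewise. Then: 1. $\mathbf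 Q$ is $\alpha$-proper for every $\alpha<\omega_1$: for all sufficiently large regular $\kappa$, whenever $\langle N_\xi:\xi\le\alpha\rangle$ is an increasing continuous sequence of countable elementary submodels of $H(\kappa)$ with $\mathbf Q\in N_0$ and $\langle N_\xi:\xi\le\eta\rangle\in N_{\eta+1}$ for every $\eta<\alpha$, every $p\in\mathbf Q\cap N_0$ has an extension $q\le p$ which is $(N_\xi,\mathbf Q)$-generic for every $\xi\le\alpha$ (that is, for each dense $D\subseteq\mathbf Q$ with $D\in N_\xi$, the set $D\cap N_\xi$ is predense below $q$). 2. $\mathbf Q$ has the strong $PP$-property: for every $h:\omega\to\omega$ in the ground model diverging to infinity, every $p\in\mathbf Q$ and every $\mathbf Q$-name $f$ with $p\Vdash f:\omega\to\omega$, there are $q\le p$ and a tree $T\subseteq\omega^{<\omega}$ in the ground model (closed under initial segments, with finite levels) such that $|T\cap\omega^n|<h(n)$ for infinitely many $n$ and $q\Vdash f\in\operatorname{Lim}T$, i.e. $q\Vdash f\restriction n\in T$ for all $n$. -/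

import Mathlib

open Filter Set

namespace CccForcing

/-! ### ccc P-filters on `ω` -/

/-- A ccc P-filter on `ω`: a proper filter `F` containing all cofinite sets (so that it corresponds
to a nonempty closed subset of `ω*`), such that countably many members of `F` have a
pseudo-intersection in `F`, and such that every antichain of `P(ω)/F` is countable.
The dual ideal `I` consists of the sets whose complement is in `F`. -/
structure IsCccPFilter (F : Filter ℕ) : Prop where
  neBot : F.NeBot
  le_cofinite : F ≤ cofinite
  pseudoInter : ∀ A : ℕ → Set ℕ, (∀ n, A n ∈ F) → ∃ B ∈ F, ∀ n, (B \ A n).Finite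
  ccc : ∀ 𝒜 : Set (Set ℕ), (∀ A ∈ 𝒜, Aᶜ ∉ F) →
    (∀ A ∈ 𝒜, ∀ B ∈ 𝒜, A ≠ B → (A ∩ B)ᶜ ∈ F) → 𝒜.Countable

/-! ### Trees on subsets of `ω` -/

/-- A tree: a partial order on a set `carrier ⊆ ω` in which the predecessors of every element are
linearly ordered and `i ≤_T j` implies `i ≤ j` (so antisymmetry is automatic). The relation `le`
lives on `carrier` only. -/
@[ext]
structure NatTree where
  carrier : Set ℕ
  le : ℕ → ℕ → Prop
  mem_of_le : ∀ {i j}, le i j → i ∈ carrier ∧ j ∈ carrier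
  refl : ∀ {i}, i ∈ carrier → le i i
  trans : ∀ {i j k}, le i j → le j k → le i k
  linear_below : ∀ {i j k}, le i k → le j k → le i j ∨ le j i
  le_nat : ∀ {i j}, le i j → i ≤ j

namespace NatTree

/-- A branch of `T`: a maximal chain. -/
def IsBranch (T : NatTree) (B : Set ℕ) : Prop :=
  B ⊆ T.carrier ∧ IsChain T.le B ∧
    ∀ C : Set ℕ, C ⊆ T.carrier → IsChain T.le C → B ⊆ C → C = B

/-- `T ≤_t S`: `S` is a subordering of `T` and every branch of `T` contains cofinally
a unique branch of `S`. -/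
def Extends (T S : NatTree) : Prop :=
  S.carrier ⊆ T.carrier ∧
  (∀ i ∈ S.carrier, ∀ j ∈ S.carrier, (S.le i j ↔ T.le i j)) ∧
  ∀ B, T.IsBranch B → ∃! b, S.IsBranch b ∧ b ⊆ B ∧ ∀ i ∈ B, ∃ j ∈ b, T.le i j

/-- `T^{(n)}`: delete the numbers `≤ n` from `T`. -/
def cut (T : NatTree) (n : ℕ) : NatTree where
  carrier := {i | i ∈ T.carrier ∧ n < i}
  le i j := T.le i j ∧ n < i ∧ n < j
  mem_of_le h := ⟨⟨(T.mem_of_le h.1).1, h.2.1⟩, (T.mem_of_le h.1).2, h.2.2⟩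
  refl h := ⟨T.refl h.1, h.2, h.2⟩
  trans h h' := ⟨T.trans h.1 h'.1, h.2.1, h'.2.2⟩
  linear_below h h' := (T.linear_below h.1 h'.1).imp
    (fun e => ⟨e, h.2.1, h'.2.1⟩) (fun e => ⟨e, h'.2.1, h.2.1⟩)
  le_nat h := T.le_nat h.1

/-- `T` is order isomorphic to the full binary tree `2^{<ω}` (finite zero-one sequences ordered by
end-extension). -/
def IsFullBinary (T : NatTree) : Prop :=
  ∃ e : T.carrier ≃ List Bool, ∀ i j : T.carrier, T.le i j ↔ e i <+: e j

theorem Extends.rfl' (T : NatTree) : T.Extends T := by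
  refine ⟨Subset.rfl, fun i _ j _ => Iff.rfl, fun B hB => ⟨B, ⟨hB, Subset.rfl, ?_⟩, ?_⟩⟩
  · exact fun i hi => ⟨i, hi, T.refl (hB.1 hi)⟩
  · rintro b ⟨hb, hbB, -⟩
    exact (hb.2.2 B hB.1 hB.2.1 hbB).symm

theorem Extends.trans' {T S U : NatTree} (h : T.Extends S) (h' : S.Extends U) : T.Extends U := by
  have hle : ∀ i ∈ U.carrier, ∀ j ∈ U.carrier, (U.le i j ↔ T.le i j) := fun i hi j hj =>
    (h'.2.1 i hi j hj).trans (h.2.1 i (h'.1 hi) j (h'.1 hj))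
  refine ⟨h'.1.trans h.1, hle, fun B hB => ?_⟩
  obtain ⟨b, ⟨hb, hbB, hcof⟩, -⟩ := h.2.2 B hB
  obtain ⟨c, ⟨hc, hcb, hcof'⟩, -⟩ := h'.2.2 b hb
  refine ⟨c, ⟨hc, hcb.trans hbB, ?_⟩, ?_⟩
  · intro i hi
    obtain ⟨j, hj, hij⟩ := hcof i hi
    obtain ⟨k, hk, hjk⟩ := hcof' j hj
    exact ⟨k, hk, T.trans hij ((h.2.1 j (hb.1 hj) k (h'.1 (hc.1 hk))).1 hjk)⟩
  · rintro c' ⟨hc', hcB', -⟩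
    have hch : IsChain U.le (B ∩ U.carrier) := fun i hi j hj hij =>
      (hB.2.1 hi.1 hj.1 hij).imp (hle i hi.2 j hj.2).2 (hle j hj.2 i hi.2).2
    rw [← hc.2.2 _ inter_subset_right hch (subset_inter (hcb.trans hbB) hc.1),
      ← hc'.2.2 _ inter_subset_right hch (subset_inter hcB' hc'.1)]

end NatTree

/-! ### The forcings `P(F)` and `Q(F)` -/

/-- The tree `T₀` from which `P(F)` is built: a full binary tree of height `ω` in the dual ideal. -/
def IsBaseTree (F : Filter ℕ) (T₀ : NatTree) : Prop :=
  T₀.carrierᶜ ∈ F ∧ T₀.IsFullBinary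

/-- Conditions of `P(F)` (built from `T₀`): pairs `⟨T, f⟩` with `T` a tree in the dual ideal,
`T ≤_t T₀^{(n)}` for some `n`, and `f : T → {0,1}`. -/
structure PForcing (F : Filter ℕ) (T₀ : NatTree) where
  tree : NatTree
  compl_mem : tree.carrierᶜ ∈ F
  extends_base : ∃ n, tree.Extends (T₀.cut n)
  val : tree.carrier → Bool

/-- `p ≤ q` (`p` is stronger) iff `T_p ≤_t T_q` and `f_p` extends `f_q`. -/
instance (F : Filter ℕ) (T₀ : NatTree) : Preorder (PForcing F T₀) where
  le p q := p.tree.Extends q.tree ∧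
    ∀ i (hp : i ∈ p.tree.carrier) (hq : i ∈ q.tree.carrier), p.val ⟨i, hp⟩ = q.val ⟨i, hq⟩
  le_refl p := ⟨.rfl' _, fun _ _ _ => rfl⟩
  le_trans _ _ _ h h' := ⟨h.1.trans' h'.1, fun i hp hr =>
    (h.2 i hp (h'.1.1 hr)).trans (h'.2 i (h'.1.1 hr) hr)⟩

/-- `Q(F)`: the full countable product of `P(F)`, ordered coordinatewise. -/
abbrev QForcing (F : Filter ℕ) (T₀ : NatTree) : Type := ℕ → PForcing F T₀

/-! ### Elementary submodels of `H(κ)` -/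

/-- The only symbol of the language of set theory. -/
inductive SetRel : ℕ → Type
  | mem : SetRel 2

/-- The first-order language of set theory. -/
def setLang : FirstOrder.Language := ⟨fun _ => Empty, SetRel⟩

/-- `x ∈ H(κ)`, for infinite `κ`: the transitive closure of `x` has fewer than `κ` elements. -/
def InH (κ : Cardinal.{0}) (x : ZFSet.{0}) : Prop :=
  ∃ t : ZFSet.{0}, t.IsTransitive ∧ x ⊆ t ∧ t.card < κ

/-- `H(κ)`. -/
def H (κ : Cardinal.{0}) : Type 1 := {x : ZFSet.{0} // InH κ x}

/-- `H(κ)` as a structure with the true membership relation. -/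
instance (κ : Cardinal.{0}) : setLang.Structure (H κ) where
  funMap f := Empty.elim f
  RelMap r := match r with
    | .mem => fun v => (v 0).1 ∈ (v 1).1

/-- `N` is a countable elementary submodel of `H(κ)`. -/
def IsCountableElementary (κ : Cardinal.{0}) (N : ZFSet.{0}) : Prop :=
  (N : Set ZFSet.{0}).Countable ∧
  ∃ S : setLang.ElementarySubstructure (H κ), ∀ x, x ∈ N ↔ ∃ y ∈ S, y.1 = x

/-- The sequence `⟨N_ξ : ξ ≤ η⟩` as a set. -/
noncomputable def seqUpTo (N : Ordinal.{0} → ZFSet.{0}) (η : Ordinal.{0}) : ZFSet.{0} :=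
  ZFSet.range fun ξ : Iic η => ZFSet.pair ξ.1.toZFSet (N ξ)

/-- `⟨N_ξ : ξ ≤ α⟩` is a continuous increasing sequence of countable elementary submodels of `H(κ)`
with `⟨N_ξ : ξ ≤ η⟩ ∈ N_{η+1}` for all `η < α`. -/
structure IsModelChain (κ : Cardinal.{0}) (α : Ordinal.{0}) (N : Ordinal.{0} → ZFSet.{0}) :
    Prop where
  elementary : ∀ ξ ≤ α, IsCountableElementary κ (N ξ)
  mono : ∀ ξ η, ξ ≤ η → η ≤ α → N ξ ⊆ N η
  continuous : ∀ γ ≤ α, Order.IsSuccLimit γ → ∀ x, x ∈ N γ ↔ ∃ ξ < γ, x ∈ N ξ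
  seq_mem : ∀ η < α, seqUpTo N η ∈ N (Order.succ η)

/-! ### `α`-properness -/

/-- Two conditions are compatible if they have a common extension. -/
def Compat {P : Type} [Preorder P] (p q : P) : Prop := ∃ r, r ≤ p ∧ r ≤ q

/-- A representation of the forcing `P` as a set `⟨A, ≤_A⟩` of the universe of sets: `P` is
identified with the elements of `A`, and `rel` is the ordering as a set of ordered pairs. -/
structure SetCoding (P : Type) [Preorder P] where
  carrier : ZFSet.{0}
  rel : ZFSet.{0}
  code : P → ZFSet.{0}
  code_injective : Function.Injective code
  mem_carrier : ∀ x, x ∈ carrier ↔ ∃ p, code p = x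
  mem_rel : ∀ z, z ∈ rel ↔ ∃ p q, p ≤ q ∧ z = ZFSet.pair (code p) (code q)

/-- Every forcing has such a representation. -/
theorem SetCoding.nonempty (P : Type) [Preorder P] : Nonempty (SetCoding P) := by
  let f : P → ZFSet.{0} := fun p => (Ordinal.typein (WellOrderingRel (α := P)) p).toZFSet
  have hf : Function.Injective f := fun p q h =>
    Ordinal.typein_injective _ (Ordinal.toZFSet_injective h)
  refine ⟨⟨ZFSet.range f, ZFSet.range fun z : {z : P × P // z.1 ≤ z.2} =>
    ZFSet.pair (f z.1.1) (f z.1.2), f, hf, fun x => by simp, fun z => ?_⟩⟩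
  simp only [ZFSet.mem_range, Subtype.exists, Prod.exists]
  constructor
  · rintro ⟨p, q, h, rfl⟩
    exact ⟨p, q, h, rfl⟩
  · rintro ⟨p, q, h, rfl⟩
    exact ⟨p, q, h, rfl⟩

/-- The forcing as one set `⟨A, ≤_A⟩`. -/
noncomputable def SetCoding.poset {P : Type} [Preorder P] (c : SetCoding P) : ZFSet.{0} :=
  ZFSet.pair c.carrier c.rel

/-- `q` is `(N, P)`-generic: for every dense `D ⊆ P` with `D ∈ N`, `D ∩ N` is predense below `q`. -/
def IsGenericFor {P : Type} [Preorder P] (c : SetCoding P) (N : ZFSet.{0}) (q : P) : Prop :=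
  ∀ D ∈ N, D ⊆ c.carrier → (∀ p, ∃ d ≤ p, c.code d ∈ D) →
    ∀ r ≤ q, ∃ d, c.code d ∈ D ∧ c.code d ∈ N ∧ Compat d r

/-- `P` is `α`-proper: for all sufficiently large regular `κ`, for every chain `⟨N_ξ : ξ ≤ α⟩` of
countable elementary submodels of `H(κ)` as above with `P ∈ N_0`, every `p ∈ P ∩ N_0` has an
extension which is `(N_ξ, P)`-generic for all `ξ ≤ α`. -/
def AlphaProper (α : Ordinal.{0}) (P : Type) [Preorder P] : Prop :=
  ∀ c : SetCoding P, ∃ κ₀ : Cardinal.{0}, ∀ κ : Cardinal.{0}, κ₀ ≤ κ → κ.IsRegular →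
    Cardinal.aleph0 < κ → ∀ N : Ordinal.{0} → ZFSet.{0}, IsModelChain κ α N → c.poset ∈ N 0 →
      ∀ p : P, c.code p ∈ N 0 → ∃ q ≤ p, ∀ ξ ≤ α, IsGenericFor c (N ξ) q

/-! ### The strong PP-property -/

/-- A (nice) `P`-name for a subset of `ω × ω`: in the extension by the generic filter `G` it is
`{(n, m) : (t, n, m) ∈ τ for some t ∈ G}`. -/
abbrev RelName (P : Type) : Type := Set (P × ℕ × ℕ)

/-- `p ⊩ (n, m) ∈ τ`. -/
def Forces {P : Type} [Preorder P] (p : P) (τ : RelName P) (n m : ℕ) : Prop :=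
  ∀ r ≤ p, ∃ s ≤ r, ∃ t, (t, n, m) ∈ τ ∧ s ≤ t

/-- `p ⊩ "τ is a function from ω to ω"`. -/
def ForcesFunction {P : Type} [Preorder P] (p : P) (τ : RelName P) : Prop :=
  (∀ n, ∀ r ≤ p, ∃ s ≤ r, ∃ m, Forces s τ n m) ∧
  ∀ n m m', m ≠ m' → ∀ r ≤ p, ¬ (Forces r τ n m ∧ Forces r τ n m')

/-- `q ⊩ "τ ∈ Lim T"`: for every `n` it is forced that `τ ↾ n ∈ T`. -/
def ForcesLim {P : Type} [Preorder P] (q : P) (τ : RelName P) (T : Set (List ℕ)) : Prop :=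
  ∀ n, ∀ r ≤ q, ∃ s ≤ r, ∃ σ ∈ T, σ.length = n ∧ ∀ i (hi : i < σ.length), Forces s τ i σ[i]

/-- The strong PP-property: whenever `h : ω → ω` diverges to infinity, every function `f : ω → ω`
of the extension is in `Lim T` for a ground model tree `T ⊆ ω^{<ω}` with finite levels such that
`|T ∩ ω^n| < h(n)` for infinitely many `n`. -/
def StrongPP (P : Type) [Preorder P] : Prop :=
  ∀ h : ℕ → ℕ, Tendsto h atTop atTop → ∀ (p : P) (τ : RelName P), ForcesFunction p τ →
    ∃ q ≤ p, ∃ T : Set (List ℕ),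
      (∀ σ ∈ T, ∀ ρ, ρ <+: σ → ρ ∈ T) ∧
      (∀ n, {σ ∈ T | σ.length = n}.Finite) ∧
      (∀ k, ∃ n ≥ k, {σ ∈ T | σ.length = n}.ncard < h n) ∧
      ForcesLim q τ T

end CccForcing

namespace CccForcing

/-! ### Trees: finite branching, cofinal extensions, restriction and insertion. -/

namespace NatTree

/-! Everything rests on `LeAt n`: extension adding no numbers below `n` to the first `n` trees. Its
main properties, collected in `FusionOrder`, give both conclusions with no further mention of trees.

Finiteness (`QForcing.exists_predense`): all trees involved are finitely branching, so a condition
`p` has only finitely many extensions whose new elements lie in the `n × n` box of coordinates and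
numbers. Treating them one after another, any dense set is met predensely by a finite set below some
`q` with `LeAt n q p`. The size of the finite set is bounded in terms of `p` and `n` alone.

Fusion (`QForcing.exists_fusion`): the union of a descending sequence of trees may leave the dual
ideal. A ccc filter is not meager (`exists_inter_Ico_eq_empty`), since otherwise an almost disjoint
family of size continuum would give an uncountable antichain. Together with a pseudo-intersection of
the complements of all trees that can occur, this yields a choice of the numbers `n` for which all
unions stay in the ideal.

Reflection (`exists_test`, `countable_covers`): an arbitrary coding shows an elementary submodel the
forcing only as an abstract order, so `LeAt n` must be recovered from `≤`. Below `p` it amounts to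
compatibility with finitely many covers of `p`, each inserting one number with one value. There are
countably many covers, so they lie in every model containing `p`, and elementarity can produce `q`
with `LeAt n q p` inside the model.

For `α`-properness, one fusion inside a model makes a condition generic for it; induction on the
length of the chain handles successors by reflecting into the next model and limits by another
fusion. For the PP-property, stage `k` of a fusion uses a level `m` with `h m` above the bound for
predense sets and captures the name up to `m` by fewer than `h m` sequences. -/

/-- `S` is a suborder of `T` and every element of `T` lies below an element of `S`. -/
def CofExt (T S : NatTree) : Prop :=
  S.carrier ⊆ T.carrier ∧
  (∀ i ∈ S.carrier, ∀ j ∈ S.carrier, (S.le i j ↔ T.le i j)) ∧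
  ∀ t ∈ T.carrier, ∃ s ∈ S.carrier, T.le t s

/-- The minimal elements of the part of `S` consisting of numbers `≥ x`. -/
def frontier (S : NatTree) (x : ℕ) : Set ℕ :=
  {c | c ∈ S.carrier ∧ x ≤ c ∧ ∀ b, S.le b c → b ≠ c → b < x}

/-- All frontiers are finite; this is a form of finite branching. -/
def FrontierFinite (S : NatTree) : Prop := ∀ x, (S.frontier x).Finite

theorem exists_frontier_le (S : NatTree) {x s : ℕ} (hs : s ∈ S.carrier) (hx : x ≤ s) :
    ∃ c ∈ S.frontier x, S.le c s := by
  classical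
  have hex : ∃ c, S.le c s ∧ x ≤ c := ⟨s, S.refl hs, hx⟩
  obtain ⟨h1, h2⟩ := Nat.find_spec hex
  refine ⟨Nat.find hex, ⟨(S.mem_of_le h1).1, h2, fun b hb hne => ?_⟩, h1⟩
  by_contra hxb
  exact hne (Nat.le_antisymm (S.le_nat hb) (Nat.find_min' hex ⟨S.trans hb h1, not_lt.1 hxb⟩))

/-- The frontier element below `s` is the least predecessor of `s` that is `≥ x`. -/
theorem frontier_le_of_le (S : NatTree) {x c b s : ℕ} (hc : c ∈ S.frontier x) (hcs : S.le c s)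
    (hbs : S.le b s) (hb : x ≤ b) : S.le c b := by
  rcases S.linear_below hcs hbs with h | h
  · exact h
  · by_cases hne : b = c
    · exact hne ▸ S.refl (S.mem_of_le hbs).1
    · exact absurd (hc.2.2 b h hne) (not_lt.2 hb)

theorem IsBranch.mem_of_comparable {T : NatTree} {B : Set ℕ} (hB : T.IsBranch B) {c : ℕ}
    (hc : c ∈ T.carrier) (h : ∀ b ∈ B, T.le b c ∨ T.le c b) : c ∈ B := by
  have := hB.2.2 (insert c B) (insert_subset hc hB.1)
    (hB.2.1.insert fun b hb _ => (h b hb).symm) (subset_insert _ _)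
  exact this ▸ mem_insert c B

theorem IsBranch.total {T : NatTree} {B : Set ℕ} (hB : T.IsBranch B) {a b : ℕ} (ha : a ∈ B)
    (hb : b ∈ B) : T.le a b ∨ T.le b a := by
  by_cases h : a = b
  · exact .inl (h ▸ T.refl (hB.1 ha))
  · exact hB.2.1 ha hb h

theorem IsBranch.mem_of_le {T : NatTree} {B : Set ℕ} (hB : T.IsBranch B) {a b : ℕ} (hb : b ∈ B)
    (hab : T.le a b) : a ∈ B := by
  refine hB.mem_of_comparable (T.mem_of_le hab).1 fun c hc => ?_
  rcases hB.total hc hb with h | h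
  · exact T.linear_below h hab
  · exact .inr (T.trans hab h)

theorem exists_branch (T : NatTree) {t : ℕ} (ht : t ∈ T.carrier) : ∃ B, T.IsBranch B ∧ t ∈ B := by
  obtain ⟨M, hM, hM'⟩ := zorn_subset_nonempty {C | C ⊆ T.carrier ∧ IsChain T.le C}
    (fun c hc hch _ => ⟨⋃₀ c, ⟨sUnion_subset fun s hs => (hc hs).1, by
      rintro a ⟨s, hs, has⟩ b ⟨s', hs', hbs⟩ hab
      rcases hch.total hs hs' with h | h
      · exact (hc hs').2 (h has) hbs hab
      · exact (hc hs).2 has (h hbs) hab⟩,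
      fun s hs => subset_sUnion_of_mem hs⟩) {t} ⟨by simpa using ht, IsChain.singleton⟩
  exact ⟨M, ⟨hM'.prop.1, hM'.prop.2, fun C hC hC' h => (hM'.eq_of_subset ⟨hC, hC'⟩ h).symm⟩,
    hM rfl⟩

theorem Extends.cofExt {T S : NatTree} (h : T.Extends S) : T.CofExt S := by
  refine ⟨h.1, h.2.1, fun t ht => ?_⟩
  obtain ⟨B, hB, htB⟩ := T.exists_branch ht
  obtain ⟨b, ⟨hb, -, hc⟩, -⟩ := h.2.2 B hB
  obtain ⟨j, hj, hj'⟩ := hc t htB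
  exact ⟨j, hb.1 hj, hj'⟩

/-- A frontier element `c` of `T` lies below some `s` in `S`. The frontier element of `S` below `s`
is then above `c`, so `c` is bounded by one of finitely many numbers. -/
theorem CofExt.frontierFinite {T S : NatTree} (h : T.CofExt S) (hS : S.FrontierFinite) :
    T.FrontierFinite := by
  intro x
  refine ((hS x).biUnion fun s _ => finite_Iic s).subset fun c hc => ?_
  obtain ⟨s, hs, hcs⟩ := h.2.2 c hc.1
  obtain ⟨s', hs', hss⟩ := S.exists_frontier_le hs (hc.2.1.trans (T.le_nat hcs))
  exact mem_biUnion hs' (T.le_nat (T.frontier_le_of_le hc hcs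
    ((h.2.1 s' hs'.1 s hs).1 hss) hs'.2.1))

/-- A branch of `T` meets `S` cofinally as soon as `T` is a cofinal extension of a finitely
branching tree `S`. -/
theorem CofExt.exists_mem_branch {T S : NatTree} (h : T.CofExt S) (hS : S.FrontierFinite)
    {B : Set ℕ} (hB : T.IsBranch B) {i : ℕ} (hi : i ∈ B) : ∃ j ∈ B, j ∈ S.carrier ∧ T.le i j := by
  by_contra! hcon
  obtain ⟨K, hK⟩ : ∃ K, K = {s ∈ S.frontier i | T.le i s} := ⟨_, rfl⟩
  have hKfin : K.Finite := hK ▸ (hS i).subset fun s hs => hs.1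
  -- The frontier element of `S` under a bound of `b` is comparable with `b`; if it were below `b`,
  -- it would itself lie in `B`.
  have key : ∀ b ∈ B, T.le i b → ∃ s ∈ K, T.le b s := by
    intro b hb hib
    obtain ⟨s, hs, hbs⟩ := h.2.2 b (hB.1 hb)
    have his := T.trans hib hbs
    obtain ⟨s', hs', hss⟩ := S.exists_frontier_le hs (T.le_nat his)
    have hss' := (h.2.1 s' hs'.1 s hs).1 hss
    have his' : T.le i s' := by
      rcases T.linear_below his hss' with h1 | h1
      · exact h1
      · rw [Nat.le_antisymm (T.le_nat h1) hs'.2.1]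
        exact T.refl (hB.1 hi)
    refine ⟨s', hK ▸ ⟨hs', his'⟩, ?_⟩
    rcases T.linear_below hbs hss' with h1 | h1
    · exact h1
    · exact absurd his' (hcon s' (hB.mem_of_le hb h1) hs'.1)
  -- Pigeonhole: otherwise each `s` in the finite set `K` fails at some point of the chain `B`, and
  -- the largest of these points contradicts `key`. The resulting bound of `B` belongs to `B` by
  -- maximality.
  have hall : ∃ s ∈ K, ∀ b ∈ B, T.le b s := by
    by_contra! hno
    choose! f hf hfs using hno
    obtain ⟨b, hb, hmax⟩ : ∃ b ∈ B, T.le i b ∧ ∀ s ∈ K, T.le (f s) b := by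
      clear key hfs hK
      induction K, hKfin using Set.Finite.induction_on with
      | empty => exact ⟨i, hi, T.refl (hB.1 hi), by simp⟩
      | @insert a s _ _ ih =>
        obtain ⟨b, hb, hib, hb'⟩ := ih fun s hs => hf s (.inr hs)
        rcases hB.total hb (hf a (.inl rfl)) with h1 | h1
        · refine ⟨f a, hf a (.inl rfl), T.trans hib h1, ?_⟩
          rintro t (rfl | ht)
          · exact T.refl (hB.1 (hf _ (.inl rfl)))
          · exact T.trans (hb' t ht) h1
        · refine ⟨b, hb, hib, ?_⟩
          rintro t (rfl | ht)
          exacts [h1, hb' t ht]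
    obtain ⟨s, hs, hbs⟩ := key b hb hmax.1
    exact hfs s hs (T.trans (hmax.2 s hs) hbs)
  obtain ⟨s, hs, hsB⟩ := hall
  rw [hK] at hs
  exact hcon s (hB.mem_of_comparable (h.1 hs.1.1) fun b hb => .inl (hsB b hb)) hs.1.1 hs.2

/-- The required branch is the trace of `B` on `S`: cofinality of the trace in `B` makes it maximal,
and any branch of `S` inside `B` is contained in it. -/
theorem CofExt.extends {T S : NatTree} (h : T.CofExt S) (hS : S.FrontierFinite) : T.Extends S := by
  refine ⟨h.1, h.2.1, fun B hB => ?_⟩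
  have hch : IsChain S.le (B ∩ S.carrier) := fun i hi j hj hij =>
    (hB.2.1 hi.1 hj.1 hij).imp (h.2.1 i hi.2 j hj.2).2 (h.2.1 j hj.2 i hi.2).2
  refine ⟨B ∩ S.carrier, ⟨⟨inter_subset_right, hch, fun C hC hCch hsub => ?_⟩,
    inter_subset_left, fun i hi => ?_⟩, ?_⟩
  · refine Subset.antisymm (fun c hc => ⟨?_, hC hc⟩) hsub
    refine hB.mem_of_comparable (h.1 (hC hc)) fun b hb => ?_
    obtain ⟨j, hj, hjS, hbj⟩ := h.exists_mem_branch hS hB hb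
    by_cases hjc : j = c
    · exact .inl (hjc ▸ hbj)
    · rcases hCch (hsub ⟨hj, hjS⟩) hc hjc with h1 | h1
      · exact .inl (T.trans hbj ((h.2.1 j hjS c (hC hc)).1 h1))
      · exact T.linear_below hbj ((h.2.1 c (hC hc) j hjS).1 h1)
  · obtain ⟨j, hj, hjS, hij⟩ := h.exists_mem_branch hS hB hi
    exact ⟨j, ⟨hj, hjS⟩, hij⟩
  · rintro b ⟨hb, hbB, -⟩
    exact (hb.2.2 _ inter_subset_right hch (subset_inter hbB hb.1)).symm

/-- Finite branching eliminates branches from the ordering, leaving a condition on single elements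
that restriction, insertion and unions visibly preserve. -/
theorem extends_iff {T S : NatTree} (hS : S.FrontierFinite) : T.Extends S ↔ T.CofExt S :=
  ⟨Extends.cofExt, fun h => h.extends hS⟩

theorem cut_frontierFinite {T : NatTree} (h : T.FrontierFinite) (n : ℕ) :
    (T.cut n).FrontierFinite := by
  intro x
  refine ((h (max x (n + 1))).union (finite_Iio (max x (n + 1)))).subset fun c hc => ?_
  by_cases hcx : c < max x (n + 1)
  · exact .inr hcx
  refine .inl ⟨hc.1.1, not_lt.1 hcx, fun b hb hne => ?_⟩
  by_cases hbn : n < b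
  · exact lt_max_of_lt_left (hc.2.2 b ⟨hb, hbn, hc.1.2⟩ hne)
  · exact lt_max_of_lt_right (by omega)

/-- A frontier element is the root or an immediate successor of one of the finitely many elements
below `x`. -/
theorem IsFullBinary.frontierFinite {T : NatTree} (h : T.IsFullBinary) : T.FrontierFinite := by
  obtain ⟨e, he⟩ := h
  intro x
  have hfin : (insert [] (⋃ y ∈ {y : T.carrier | y.1 < x}, ⋃ b : Bool, {e y ++ [b]})).Finite := by
    refine Finite.insert _ (Finite.biUnion ?_ fun _ _ => finite_iUnion fun _ => finite_singleton _)
    exact (finite_Iio x).preimage (Subtype.val_injective.injOn)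
  refine ((hfin.image e.symm).image Subtype.val).subset fun c hc => ?_
  refine ⟨⟨c, hc.1⟩, ⟨e ⟨c, hc.1⟩, ?_, by simp⟩, rfl⟩
  rcases List.eq_nil_or_concat (e ⟨c, hc.1⟩) with h0 | ⟨l, b, hl⟩
  · exact .inl h0
  · refine .inr (mem_biUnion (x := e.symm l) ?_ ?_)
    · have hle : T.le (e.symm l) c := (he (e.symm l) ⟨c, hc.1⟩).2 (by
        rw [hl, Equiv.apply_symm_apply]; simp)
      refine hc.2.2 _ hle fun hEq => ?_
      have : e.symm l = ⟨c, hc.1⟩ := Subtype.ext hEq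
      rw [← this, Equiv.apply_symm_apply] at hl
      simpa using congrArg List.length hl
    · simp [hl]

theorem IsFullBinary.infinite {T : NatTree} (h : T.IsFullBinary) : T.carrier.Infinite := by
  obtain ⟨e, -⟩ := h
  have : Infinite T.carrier := e.infinite_iff.2 inferInstance
  exact infinite_coe_iff.1 this

theorem cut_infinite {T : NatTree} (h : T.carrier.Infinite) (n : ℕ) :
    (T.cut n).carrier.Infinite := by
  refine (h.sdiff (finite_Iic n)).mono fun i hi => ⟨hi.1, ?_⟩
  simpa using hi.2

/-- The elements of the set `S` above `a` in `T`. -/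
def upper (T : NatTree) (S : Set ℕ) (a : ℕ) : Set ℕ := {s | s ∈ S ∧ T.le a s}

/-- The order of a cofinal extension of `S` is determined by the sets of successors in `S`. -/
theorem CofExt.le_iff {T S : NatTree} (h : T.CofExt S) {a b : ℕ} (hb : b ∈ T.carrier) :
    T.le a b ↔ a ≤ b ∧ T.upper S.carrier b ⊆ T.upper S.carrier a := by
  refine ⟨fun hab => ⟨T.le_nat hab, fun s hs => ⟨hs.1, T.trans hab hs.2⟩⟩, fun ⟨hab, hU⟩ => ?_⟩
  obtain ⟨s, hs, hbs⟩ := h.2.2 b hb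
  rcases T.linear_below (hU ⟨hs, hbs⟩).2 hbs with h1 | h1
  · exact h1
  · rw [Nat.le_antisymm hab (T.le_nat h1)]
    exact T.refl hb

/-- The successors in `S` of an element `x` of a cofinal extension are determined by the finite set
of those in the frontier of `x`. -/
theorem CofExt.mem_upper_iff {T S : NatTree} (h : T.CofExt S) {x s : ℕ} :
    s ∈ T.upper S.carrier x ↔ ∃ c ∈ S.frontier x, T.le x c ∧ S.le c s := by
  constructor
  · rintro ⟨hs, hxs⟩
    obtain ⟨c, hc, hcs⟩ := S.exists_frontier_le hs (T.le_nat hxs)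
    refine ⟨c, hc, ?_, hcs⟩
    rcases T.linear_below hxs ((h.2.1 c hc.1 s hs).1 hcs) with h1 | h1
    · exact h1
    · rw [← Nat.le_antisymm (T.le_nat h1) hc.2.1]
      exact T.refl (h.1 hc.1)
  · rintro ⟨c, hc, hxc, hcs⟩
    have hs := (S.mem_of_le hcs).2
    exact ⟨hs, T.trans hxc ((h.2.1 c hc.1 s hs).1 hcs)⟩

/-- The restriction of a tree to a subset of its carrier. -/
def restrict (T : NatTree) (C : Set ℕ) : NatTree where
  carrier := T.carrier ∩ C
  le i j := T.le i j ∧ i ∈ C ∧ j ∈ C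
  mem_of_le h := ⟨⟨(T.mem_of_le h.1).1, h.2.1⟩, (T.mem_of_le h.1).2, h.2.2⟩
  refl h := ⟨T.refl h.1, h.2, h.2⟩
  trans h h' := ⟨T.trans h.1 h'.1, h.2.1, h'.2.2⟩
  linear_below h h' := (T.linear_below h.1 h'.1).imp
    (fun e => ⟨e, h.2.1, h'.2.1⟩) (fun e => ⟨e, h'.2.1, h.2.1⟩)
  le_nat h := T.le_nat h.1

theorem CofExt.restrict_base {T S : NatTree} (h : T.CofExt S) {C : Set ℕ} (hC : S.carrier ⊆ C) :
    (T.restrict C).CofExt S :=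
  ⟨subset_inter h.1 hC, fun i hi j hj => (h.2.1 i hi j hj).trans
    ⟨fun e => ⟨e, hC hi, hC hj⟩, fun e => e.1⟩, fun t ht =>
    (h.2.2 t ht.1).imp fun _ hs => ⟨hs.1, hs.2, ht.2, hC hs.1⟩⟩

theorem CofExt.restrict_self {T S : NatTree} (h : T.CofExt S) {C : Set ℕ} (hC : S.carrier ⊆ C) :
    T.CofExt (T.restrict C) :=
  ⟨inter_subset_left, fun _ hi _ hj => ⟨fun e => e.1, fun e => ⟨e, hi.2, hj.2⟩⟩, fun t ht =>
    (h.2.2 t ht).imp fun _ hs => ⟨⟨h.1 hs.1, hC hs.1⟩, hs.2⟩⟩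

/-- Two cofinal extensions of `S`, one containing the other and inducing the same sets of
successors in `S`. -/
theorem CofExt.of_upper_eq {T T' S : NatTree} (h : T.CofExt S) (h' : T'.CofExt S)
    (hsub : T'.carrier ⊆ T.carrier) (hU : ∀ a ∈ T'.carrier, T.upper S.carrier a = T'.upper S.carrier a) :
    T.CofExt T' := by
  refine ⟨hsub, fun i hi j hj => ?_, fun t ht => (h.2.2 t ht).imp fun s hs => ⟨h'.1 hs.1, hs.2⟩⟩
  rw [h'.le_iff hj, h.le_iff (hsub hj), hU i hi, hU j hj]

theorem CofExt.upper_eq {T T' : NatTree} (h : T.CofExt T') {S : Set ℕ} (hS : S ⊆ T'.carrier) {a : ℕ}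
    (ha : a ∈ T'.carrier) : T.upper S a = T'.upper S a := by
  ext s
  exact and_congr_right fun hs => (h.2.1 a ha s (hS hs)).symm

/-- Insert the number `x ∉ T` into `T` next to `s₀`: it is put above the predecessors of `s₀` smaller
than `x`, and below all larger elements which have the same predecessors smaller than `x`. -/
def ins (T : NatTree) (x s₀ : ℕ) (hx : x ∉ T.carrier) : NatTree where
  carrier := insert x T.carrier
  le a b := T.le a b ∨ (b = x ∧ (a = x ∨ a < x ∧ T.le a s₀)) ∨
    (a = x ∧ b ∈ T.carrier ∧ x < b ∧ ∀ c < x, T.le c b ↔ T.le c s₀)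
  mem_of_le := by
    rintro i j (h | ⟨rfl, rfl | ⟨-, h⟩⟩ | ⟨rfl, h, -⟩)
    · exact ⟨.inr (T.mem_of_le h).1, .inr (T.mem_of_le h).2⟩
    · exact ⟨.inl rfl, .inl rfl⟩
    · exact ⟨.inr (T.mem_of_le h).1, .inl rfl⟩
    · exact ⟨.inl rfl, .inr h⟩
  refl := by
    rintro i (rfl | h)
    · exact .inr (.inl ⟨rfl, .inl rfl⟩)
    · exact .inl (T.refl h)
  trans := by
    rintro i j k (h | ⟨hj, hi | ⟨h1, h2⟩⟩ | ⟨hi, h1, h2, h3⟩)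
      (h' | ⟨hk, hj' | ⟨h1', h2'⟩⟩ | ⟨hj', h1', h2', h3'⟩)
    · exact .inl (T.trans h h')
    · exact absurd (T.mem_of_le h).2 (hj' ▸ hx)
    · exact .inr (.inl ⟨hk, .inr ⟨(T.le_nat h).trans_lt h1', T.trans h h2'⟩⟩)
    · exact absurd (T.mem_of_le h).2 (hj' ▸ hx)
    · exact absurd (T.mem_of_le h').1 (hj ▸ hx)
    · exact .inr (.inl ⟨hk, .inl hi⟩)
    · exact .inr (.inl ⟨hk, .inl hi⟩)
    · exact .inr (.inr ⟨hi, h1', h2', h3'⟩)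
    · exact absurd (T.mem_of_le h').1 (hj ▸ hx)
    · exact .inr (.inl ⟨hk, .inr ⟨h1, h2⟩⟩)
    · exact .inr (.inl ⟨hk, .inr ⟨h1, h2⟩⟩)
    · exact .inl ((h3' i h1).2 h2)
    · refine .inr (.inr ⟨hi, (T.mem_of_le h').2, h2.trans_le (T.le_nat h'), fun c hc => ?_⟩)
      rw [← h3 c hc]
      refine ⟨fun h => ?_, fun h => T.trans h h'⟩
      rcases T.linear_below h h' with h4 | h4
      · exact h4
      · exact absurd (T.le_nat h4) (by omega)
    · exact absurd h1 (hj' ▸ hx)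
    · omega
    · exact absurd h1 (hj' ▸ hx)
  linear_below := by
    rintro i j k (h | ⟨rfl, rfl | ⟨h1, h2⟩⟩ | ⟨rfl, h1, h2, h3⟩)
      (h' | ⟨hk, rfl | ⟨h1', h2'⟩⟩ | ⟨rfl, h1', h2', h3'⟩)
    · exact (T.linear_below h h').imp .inl .inl
    · exact absurd (T.mem_of_le h).2 (hk ▸ hx)
    · exact absurd (T.mem_of_le h).2 (hk ▸ hx)
    · rcases lt_trichotomy i j with h4 | h4 | h4
      · exact .inl (.inr (.inl ⟨rfl, .inr ⟨h4, (h3' i h4).1 h⟩⟩))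
      · exact absurd (T.mem_of_le h).1 (h4 ▸ hx)
      · refine .inr (.inr (.inr ⟨rfl, (T.mem_of_le h).1, h4, fun c hc => ?_⟩))
        rw [← h3' c hc]
        refine ⟨fun h5 => T.trans h5 h, fun h5 => ?_⟩
        rcases T.linear_below h5 h with h6 | h6
        · exact h6
        · exact absurd (T.le_nat h6) (by omega)
    · exact absurd (T.mem_of_le h').2 hx
    · exact .inl (.inr (.inl ⟨rfl, .inl rfl⟩))
    · exact .inr (.inr (.inl ⟨rfl, .inr ⟨h1', h2'⟩⟩))
    · exact absurd h1' hx
    · exact absurd (T.mem_of_le h').2 hx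
    · exact .inl (.inr (.inl ⟨rfl, .inr ⟨h1, h2⟩⟩))
    · exact (T.linear_below h2 h2').imp .inl .inl
    · exact absurd h1' hx
    · rcases lt_trichotomy j i with h4 | h4 | h4
      · exact .inr (.inr (.inl ⟨rfl, .inr ⟨h4, (h3 j h4).1 h'⟩⟩))
      · exact absurd (T.mem_of_le h').1 (h4 ▸ hx)
      · refine .inl (.inr (.inr ⟨rfl, (T.mem_of_le h').1, h4, fun c hc => ?_⟩))
        rw [← h3 c hc]
        refine ⟨fun h5 => T.trans h5 h', fun h5 => ?_⟩
        rcases T.linear_below h5 h' with h6 | h6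
        · exact h6
        · exact absurd (T.le_nat h6) (by omega)
    · omega
    · omega
    · exact .inl (.inr (.inl ⟨rfl, .inl rfl⟩))
  le_nat := by
    rintro i j (h | ⟨rfl, rfl | ⟨h, -⟩⟩ | ⟨rfl, -, h, -⟩)
    exacts [T.le_nat h, le_rfl, h.le, h.le]

theorem ins_cofExt (T : NatTree) {x s₀ : ℕ} (hx : x ∉ T.carrier) (hs : s₀ ∈ T.carrier)
    (hxs : x < s₀) : (T.ins x s₀ hx).CofExt T := by
  refine ⟨subset_insert _ _, fun i hi j hj => ⟨.inl, ?_⟩, ?_⟩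
  · rintro (h | ⟨rfl, -⟩ | ⟨rfl, -⟩)
    exacts [h, absurd hj hx, absurd hi hx]
  · rintro t (rfl | ht)
    · exact ⟨s₀, hs, .inr (.inr ⟨rfl, hs, hxs, fun _ _ => Iff.rfl⟩)⟩
    · exact ⟨t, ht, .inl (T.refl ht)⟩

/-- Insertion is compatible with cofinal extensions having no new elements below `x`. -/
theorem CofExt.ins {T S : NatTree} (h : T.CofExt S) {x s₀ : ℕ} (hx : x ∉ T.carrier)
    (hx' : x ∉ S.carrier) (hs : s₀ ∈ S.carrier) (hxs : x < s₀)
    (hlow : ∀ y < x, y ∈ T.carrier → y ∈ S.carrier) :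
    (T.ins x s₀ hx).CofExt (S.ins x s₀ hx') := by
  -- Both trees have the same elements below `x`, so the clauses defining the position of `x` mean
  -- the same in both.
  have hpre : ∀ s ∈ S.carrier, ∀ c < x, (T.le c s ↔ S.le c s) := fun s hs c hc =>
    ⟨fun e => (h.2.1 c (hlow c hc (T.mem_of_le e).1) s hs).2 e,
      fun e => (h.2.1 c (S.mem_of_le e).1 s hs).1 e⟩
  refine ⟨insert_subset_insert h.1, fun i hi j hj => ?_, ?_⟩
  · have h1 : S.le i j ↔ T.le i j := by
      rcases hi with rfl | hi
      · exact ⟨fun e => absurd (S.mem_of_le e).1 hx', fun e => absurd (T.mem_of_le e).1 hx⟩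
      rcases hj with rfl | hj
      · exact ⟨fun e => absurd (S.mem_of_le e).2 hx', fun e => absurd (T.mem_of_le e).2 hx⟩
      exact h.2.1 i hi j hj
    refine or_congr h1 (or_congr (and_congr_right fun _ => or_congr_right
      (and_congr_right fun hix => (hpre s₀ hs i hix).symm)) (and_congr_right fun _ => ?_))
    constructor
    · rintro ⟨h2, h3, h4⟩
      exact ⟨h.1 h2, h3, fun c hc => by rw [hpre j h2 c hc, hpre s₀ hs c hc, h4 c hc]⟩
    · rintro ⟨h2, h3, h4⟩
      have hjS : j ∈ S.carrier := hj.resolve_left (by omega)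
      exact ⟨hjS, h3, fun c hc => by rw [← hpre j hjS c hc, ← hpre s₀ hs c hc, h4 c hc]⟩
  · rintro t (rfl | ht)
    · exact ⟨t, .inl rfl, .inr (.inl ⟨rfl, .inl rfl⟩)⟩
    · obtain ⟨s, hs, hts⟩ := h.2.2 t ht
      exact ⟨s, .inr hs, .inl hts⟩

end NatTree
end CccForcing

/-! ### Conditions of the single forcing. -/

namespace CccForcing

theorem NatTree.CofExt.eq_of_carrier_subset {T S : NatTree} (h : T.CofExt S)
    (hsub : T.carrier ⊆ S.carrier) : T = S := by
  refine NatTree.ext (hsub.antisymm h.1) ?_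
  funext i j
  refine propext ⟨fun e => ?_, fun e => ?_⟩
  · exact (h.2.1 i (hsub (T.mem_of_le e).1) j (hsub (T.mem_of_le e).2)).2 e
  · exact (h.2.1 i (S.mem_of_le e).1 j (S.mem_of_le e).2).1 e

namespace PForcing

variable {F : Filter ℕ} {T₀ : NatTree}

open Classical in
/-- The function of a condition, extended by `false` outside of its tree. -/
noncomputable def eval (p : PForcing F T₀) (i : ℕ) : Bool :=
  if h : i ∈ p.tree.carrier then p.val ⟨i, h⟩ else false

theorem eval_of_mem (p : PForcing F T₀) {i : ℕ} (h : i ∈ p.tree.carrier) :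
    p.eval i = p.val ⟨i, h⟩ := dif_pos h

theorem frontierFinite (hT : T₀.IsFullBinary) (p : PForcing F T₀) : p.tree.FrontierFinite := by
  obtain ⟨n, hn⟩ := p.extends_base
  exact hn.cofExt.frontierFinite (NatTree.cut_frontierFinite hT.frontierFinite n)

theorem infinite (hT : T₀.IsFullBinary) (p : PForcing F T₀) : p.tree.carrier.Infinite := by
  obtain ⟨n, hn⟩ := p.extends_base
  exact (NatTree.cut_infinite hT.infinite n).mono hn.1

theorem le_iff (hT : T₀.IsFullBinary) {p q : PForcing F T₀} :
    p ≤ q ↔ p.tree.CofExt q.tree ∧ ∀ i ∈ q.tree.carrier, p.eval i = q.eval i := by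
  have : p ≤ q ↔ p.tree.Extends q.tree ∧
    ∀ i (hp : i ∈ p.tree.carrier) (hq : i ∈ q.tree.carrier), p.val ⟨i, hp⟩ = q.val ⟨i, hq⟩ := Iff.rfl
  rw [this, NatTree.extends_iff (q.frontierFinite hT)]
  refine and_congr_right fun h => ⟨fun h' i hi => ?_, fun h' i hp hq => ?_⟩
  · rw [eval_of_mem _ (h.1 hi), eval_of_mem _ hi, h' i (h.1 hi) hi]
  · rw [← eval_of_mem _ hp, ← eval_of_mem _ hq, h' i hq]

/-- The condition given by a cofinal extension of the tree of `p` and a function. -/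
def ofExt (hT : T₀.IsFullBinary) (p : PForcing F T₀) (S : NatTree) (hS : S.carrierᶜ ∈ F)
    (h : S.CofExt p.tree) (f : ℕ → Bool) : PForcing F T₀ where
  tree := S
  compl_mem := hS
  extends_base := p.extends_base.imp fun _ hn => (h.extends (p.frontierFinite hT)).trans' hn
  val i := f i

theorem eval_ofExt (hT : T₀.IsFullBinary) (p : PForcing F T₀) {S : NatTree} (hS : S.carrierᶜ ∈ F)
    (h : S.CofExt p.tree) (f : ℕ → Bool) {i : ℕ} (hi : i ∈ S.carrier) :
    (ofExt hT p S hS h f).eval i = f i := eval_of_mem _ hi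

theorem carrier_subset {p q : PForcing F T₀} (h : p ≤ q) : q.tree.carrier ⊆ p.tree.carrier := h.1.1

theorem eval_eq (hT : T₀.IsFullBinary) {p q : PForcing F T₀} (h : p ≤ q) {i : ℕ}
    (hi : i ∈ q.tree.carrier) : p.eval i = q.eval i := ((le_iff hT).1 h).2 i hi

theorem eq_of_le_of_subset (hT : T₀.IsFullBinary) {p q : PForcing F T₀} (h : p ≤ q)
    (hsub : p.tree.carrier ⊆ q.tree.carrier) : p = q := by
  have ht : p.tree = q.tree := h.1.cofExt.eq_of_carrier_subset hsub
  have he := ((le_iff hT).1 h).2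
  obtain ⟨T, hT1, hT2, f⟩ := p
  obtain ⟨T', hT1', hT2', f'⟩ := q
  obtain rfl : T = T' := ht
  congr
  funext ⟨i, hi⟩
  simpa [eval, show i ∈ T.carrier from hi] using he i hi

/-- The order of a tree extending that of `p` is coded by successor sets in the tree of `p`.
Conditions below `p` can therefore be compared one element at a time, even when different elements
are controlled by different intermediate conditions. -/
theorem le_of_upper_eq (hT : T₀.IsFullBinary) {p d r : PForcing F T₀} (hr : r ≤ p) (hd : d ≤ p)
    (h : ∀ a ∈ d.tree.carrier, a ∈ r.tree.carrier ∧
      r.tree.upper p.tree.carrier a = d.tree.upper p.tree.carrier a ∧ r.eval a = d.eval a) :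
    r ≤ d := by
  refine (le_iff hT).2 ⟨hr.1.cofExt.of_upper_eq hd.1.cofExt (fun a ha => (h a ha).1)
    fun a ha => (h a ha).2.1, fun a ha => (h a ha).2.2⟩

theorem upper_eq {p d r : PForcing F T₀} (hr : r ≤ d) (hd : d ≤ p) {a : ℕ}
    (ha : a ∈ d.tree.carrier) :
    r.tree.upper p.tree.carrier a = d.tree.upper p.tree.carrier a :=
  hr.1.cofExt.upper_eq (carrier_subset hd) ha

/-- The restriction of a condition `d ≤ p` to a set containing the tree of `p`. -/
noncomputable def restr (hT : T₀.IsFullBinary) {d p : PForcing F T₀} (h : d ≤ p) (C : Set ℕ)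
    (hC : p.tree.carrier ⊆ C) : PForcing F T₀ :=
  ofExt hT p (d.tree.restrict C)
    (mem_of_superset d.compl_mem (compl_subset_compl.2 inter_subset_left))
    (h.1.cofExt.restrict_base hC) d.eval

section restr

variable (hT : T₀.IsFullBinary) {d p : PForcing F T₀} (h : d ≤ p) {C : Set ℕ}
  (hC : p.tree.carrier ⊆ C)

theorem eval_restr {i : ℕ} (hi : i ∈ d.tree.carrier ∩ C) :
    (restr hT h C hC).eval i = d.eval i := eval_ofExt _ _ _ _ _ hi

theorem restr_le : restr hT h C hC ≤ p :=
  (le_iff hT).2 ⟨h.1.cofExt.restrict_base hC, fun _ hi =>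
    (eval_restr hT h hC ⟨carrier_subset h hi, hC hi⟩).trans (eval_eq hT h hi)⟩

theorem le_restr : d ≤ restr hT h C hC :=
  (le_iff hT).2 ⟨h.1.cofExt.restrict_self hC, fun _ hi => (eval_restr hT h hC hi).symm⟩

end restr

/-- The condition obtained by inserting a number `x` into the tree of `p`. -/
noncomputable def insert (hF : F ≤ cofinite) (hT : T₀.IsFullBinary) (p : PForcing F T₀) {x s₀ : ℕ}
    (hx : x ∉ p.tree.carrier) (hs : s₀ ∈ p.tree.carrier) (hxs : x < s₀) (v : Bool) :
    PForcing F T₀ :=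
  ofExt hT p (p.tree.ins x s₀ hx) (by
    have : (p.tree.ins x s₀ hx).carrierᶜ = p.tree.carrierᶜ ∩ {x}ᶜ := by
      rw [inter_comm, ← compl_union]; rfl
    rw [this]
    exact inter_mem p.compl_mem (hF (finite_singleton x).compl_mem_cofinite))
    (p.tree.ins_cofExt hx hs hxs) (Function.update p.eval x v)

section insert

variable (hF : F ≤ cofinite) (hT : T₀.IsFullBinary) (p : PForcing F T₀) {x s₀ : ℕ}
    (hx : x ∉ p.tree.carrier) (hs : s₀ ∈ p.tree.carrier) (hxs : x < s₀) (v : Bool)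

theorem eval_insert_self : (p.insert hF hT hx hs hxs v).eval x = v := by
  rw [insert, eval_ofExt _ _ _ _ _ (mem_insert _ _), Function.update_self]

theorem eval_insert_of_mem {i : ℕ} (hi : i ∈ p.tree.carrier) :
    (p.insert hF hT hx hs hxs v).eval i = p.eval i := by
  rw [insert, eval_ofExt _ _ _ _ _ (mem_insert_of_mem _ hi), Function.update_of_ne]
  rintro rfl
  exact hx hi

theorem insert_le : p.insert hF hT hx hs hxs v ≤ p :=
  (le_iff hT).2 ⟨p.tree.ins_cofExt hx hs hxs, fun _ hi => p.eval_insert_of_mem _ _ _ _ _ _ hi⟩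

theorem insert_le_insert {q : PForcing F T₀} (hq : q ≤ p) (hx' : x ∉ q.tree.carrier)
    (hs' : s₀ ∈ q.tree.carrier) (hlow : ∀ y < x, y ∈ q.tree.carrier → y ∈ p.tree.carrier) :
    q.insert hF hT hx' hs' hxs v ≤ p.insert hF hT hx hs hxs v := by
  refine (le_iff hT).2 ⟨hq.1.cofExt.ins hx' hx hs hxs hlow, ?_⟩
  rintro i (rfl | hi)
  · simp only [eval_insert_self]
  · rw [eval_insert_of_mem _ _ _ _ _ _ _ hi, eval_insert_of_mem _ _ _ _ _ _ _
      (carrier_subset hq hi), eval_eq hT hq hi]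

end insert

theorem exists_total_le (hF : F ≤ cofinite) (hT : T₀.IsFullBinary) (p : PForcing F T₀) (n : ℕ) :
    ∃ q ≤ p, ∀ x < n, x ∈ q.tree.carrier := by
  induction n with
  | zero => exact ⟨p, le_rfl, by simp⟩
  | succ n ih =>
    obtain ⟨q, hq, hq'⟩ := ih
    by_cases hn : n ∈ q.tree.carrier
    · refine ⟨q, hq, fun x hx => ?_⟩
      rcases Nat.lt_succ_iff_lt_or_eq.1 hx with h | rfl
      exacts [hq' x h, hn]
    · obtain ⟨s, hs, hns⟩ := (q.infinite hT).exists_gt n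
      refine ⟨q.insert hF hT hn hs hns false, (insert_le ..).trans hq, fun x hx => ?_⟩
      rcases Nat.lt_succ_iff_lt_or_eq.1 hx with h | rfl
      exacts [.inr (hq' x h), .inl rfl]

end PForcing

/-! ### The product: the relations `LeAt`, covers, and finite predense sets. -/

namespace QForcing

variable {F : Filter ℕ} {T₀ : NatTree}

/-- `q ≤ p`, and the first `n` trees of `q` have no new elements `< n`. -/
def LeAt (n : ℕ) (q p : QForcing F T₀) : Prop :=
  q ≤ p ∧ ∀ i < n, ∀ x < n, x ∈ (q i).tree.carrier → x ∈ (p i).tree.carrier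

theorem LeAt.trans {n : ℕ} {r q p : QForcing F T₀} (h : LeAt n r q) (h' : LeAt n q p) :
    LeAt n r p :=
  ⟨h.1.trans h'.1, fun i hi x hx hr => h'.2 i hi x hx (h.2 i hi x hx hr)⟩

/-- Only one number is added in one coordinate. A condition in between either has it or not, and
comparable conditions with the same carriers coincide. -/
theorem update_insert_covBy (hF : F ≤ cofinite) (hT : T₀.IsFullBinary) (p : QForcing F T₀)
    {i x s₀ : ℕ} (hx : x ∉ (p i).tree.carrier) (hs : s₀ ∈ (p i).tree.carrier) (hxs : x < s₀)
    (v : Bool) : Function.update p i ((p i).insert hF hT hx hs hxs v) ⋖ p := by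
  set w := Function.update p i ((p i).insert hF hT hx hs hxs v) with hw
  have hwi : w i = (p i).insert hF hT hx hs hxs v := Function.update_self ..
  have hwj : ∀ j, j ≠ i → w j = p j := fun j hj => Function.update_of_ne hj ..
  have hwp : w ≤ p := update_le_self_iff.2 (PForcing.insert_le ..)
  refine ⟨⟨hwp, fun h => hx (PForcing.carrier_subset (h i) ?_)⟩, fun c hwc hcp => ?_⟩
  · rw [hwi]
    exact mem_insert _ _
  by_cases hxc : x ∈ (c i).tree.carrier
  · refine hwc.2 fun j => ?_
    by_cases hj : j = i
    · subst hj
      refine (PForcing.eq_of_le_of_subset hT (hwc.1 j) ?_).ge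
      rw [hwi]
      exact insert_subset hxc (PForcing.carrier_subset (hcp.1 j))
    · rw [hwj j hj]
      exact hcp.1 j
  · refine hcp.2 fun j => (PForcing.eq_of_le_of_subset hT (hcp.1 j) fun y hy => ?_).ge
    have hyw := PForcing.carrier_subset (hwc.1 j) hy
    by_cases hj : j = i
    · subst hj
      rw [hwi] at hyw
      exact hyw.resolve_left fun h => hxc (h ▸ hy)
    · rwa [hwj j hj] at hyw

/-- The relation `LeAt n` below `p` is decided by compatibility with finitely many covers of `p`. -/
theorem exists_test (hF : F ≤ cofinite) (hT : T₀.IsFullBinary) (p : QForcing F T₀) (n : ℕ) :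
    ∃ (ι : Type) (_ : Finite ι) (w : ι → QForcing F T₀), (∀ j, w j ⋖ p) ∧
      ∀ q ≤ p, LeAt n q p ↔ ∀ j, Compat q (w j) := by
  have hex : ∀ i x : ℕ, ∃ s ∈ (p i).tree.carrier, x < s := fun i x =>
    ((p i).infinite hT).exists_gt x
  choose s hs hxs using hex
  -- One test for each number missing from the `n × n` box and each of its two possible values.
  refine ⟨{z : Fin n × Fin n // (z.2 : ℕ) ∉ (p z.1).tree.carrier} × Bool, inferInstance,
    fun z => Function.update p z.1.1.1 ((p z.1.1.1).insert hF hT z.1.2 (hs _ _) (hxs _ _) z.2),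
    fun z => update_insert_covBy .., fun q hq => ⟨?_, fun h => ⟨hq, fun i hi x hx hxq => ?_⟩⟩⟩
  · rintro ⟨-, h⟩ ⟨⟨⟨i, x⟩, hx⟩, v⟩
    have hx' : (x : ℕ) ∉ (q i).tree.carrier := fun h' => hx (h i i.2 x x.2 h')
    refine ⟨Function.update q i ((q i).insert hF hT hx' (PForcing.carrier_subset (hq i) (hs i x))
      (hxs i x) v), update_le_self_iff.2 (PForcing.insert_le ..), fun j => ?_⟩
    by_cases hj : j = i
    · subst hj
      simp only [Function.update_self]
      exact PForcing.insert_le_insert hF hT _ hx (hs _ _) (hxs _ _) v (hq _) _ _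
        fun y hy => h i i.2 y (hy.trans x.2)
    · simpa [Function.update_of_ne hj] using hq j
  · by_contra hxp
    -- If `x` is new in `q`, its value there is already fixed, so `q` cannot be compatible with both
    -- insertions of `x`.
    have key : ∀ v, (q i).eval x = v := by
      intro v
      obtain ⟨r, hrq, hrw⟩ := h ⟨⟨⟨⟨i, hi⟩, ⟨x, hx⟩⟩, hxp⟩, v⟩
      have h1 := hrw i
      simp only [Function.update_self] at h1
      rw [← PForcing.eval_eq hT (hrq i) hxq, PForcing.eval_eq hT h1 (mem_insert _ _),
        PForcing.eval_insert_self]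
    simpa [key true] using key false

/-- The extensions of `p` all of whose new elements are numbers `< n` in the first `n`
coordinates. -/
def boundedExt (p : QForcing F T₀) (n : ℕ) : Set (QForcing F T₀) :=
  {r | r ≤ p ∧ ∀ i, ∀ x ∈ (r i).tree.carrier, x ∈ (p i).tree.carrier ∨ (i < n ∧ x < n)}

/-- The finite amount of information determining an element of `boundedExt p n`. -/
def trace (p : QForcing F T₀) (n : ℕ) (r : QForcing F T₀) : Set (ℕ × ℕ × ℕ × Bool) :=
  {z | z.1 < n ∧ z.2.1 < n ∧ z.2.2.1 ∈ (p z.1).tree.frontier z.2.1 ∧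
    (r z.1).tree.le z.2.1 z.2.2.1 ∧ (r z.1).eval z.2.1 = z.2.2.2}

/-- A new element `a` of `r'` lies below an element of the frontier at `a`, so the trace mentions
it. Equality of traces then puts `a` into `r` with the same value and the same successors in the
tree of `p`. -/
theorem le_of_trace_eq (hT : T₀.IsFullBinary) {p r r' : QForcing F T₀} {n : ℕ}
    (hr : r ∈ boundedExt p n) (hr' : r' ∈ boundedExt p n) (h : trace p n r = trace p n r') :
    r ≤ r' := by
  refine fun i => PForcing.le_of_upper_eq hT (hr.1 i) (hr'.1 i) fun a ha => ?_
  by_cases hap : a ∈ (p i).tree.carrier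
  · refine ⟨PForcing.carrier_subset (hr.1 i) hap, ?_, ?_⟩
    · rw [PForcing.upper_eq (hr.1 i) le_rfl hap, PForcing.upper_eq (hr'.1 i) le_rfl hap]
    · rw [PForcing.eval_eq hT (hr.1 i) hap, PForcing.eval_eq hT (hr'.1 i) hap]
  obtain ⟨hin, han⟩ := (hr'.2 i a ha).resolve_left hap
  have hE := (hr.1 i).1.cofExt
  have hE' := (hr'.1 i).1.cofExt
  obtain ⟨s, hs, has⟩ := hE'.2.2 a ha
  obtain ⟨c, hc, hac, -⟩ := hE'.mem_upper_iff.1 ⟨hs, has⟩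
  have hmem : (i, a, c, (r' i).eval a) ∈ trace p n r := h ▸ ⟨hin, han, hc, hac, rfl⟩
  have hev : (r i).eval a = (r' i).eval a := hmem.2.2.2.2
  refine ⟨((r i).tree.mem_of_le hmem.2.2.2.1).1, ?_, hev⟩
  ext t
  rw [hE.mem_upper_iff, hE'.mem_upper_iff]
  refine exists_congr fun c => and_congr_right fun hc => and_congr_left fun _ => ?_
  have := Set.ext_iff.1 h (i, a, c, (r' i).eval a)
  simpa [trace, hin, han, hc, hev] using this

theorem boundedExt_finite (hT : T₀.IsFullBinary) (p : QForcing F T₀) (n : ℕ) :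
    (boundedExt p n).Finite := by
  have hZ : (⋃ i ∈ Iio n, ⋃ x ∈ Iio n, (fun z : ℕ × Bool => (i, x, z.1, z.2)) ''
      ((p i).tree.frontier x ×ˢ univ)).Finite :=
    (finite_Iio n).biUnion fun i _ => (finite_Iio n).biUnion fun x _ =>
      (((p i).frontierFinite hT x).prod finite_univ).image _
  refine Finite.of_injOn (f := trace p n) (fun r _ => ?_) (fun r hr r' hr' h => ?_)
    hZ.finite_subsets
  · rintro ⟨i, x, c, v⟩ ⟨hi, hx, hc, -⟩
    exact mem_biUnion (x := i) hi (mem_biUnion (x := x) hx ⟨(c, v), ⟨hc, mem_univ _⟩, rfl⟩)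
  · exact funext fun i => PForcing.eq_of_le_of_subset hT (le_of_trace_eq hT hr hr' h i)
      (PForcing.carrier_subset (le_of_trace_eq hT hr' hr h.symm i))

/-- Pick one new element of a cover `w` and restrict `w` to `p` together with it. The result lies
between `w` and `p` and differs from `p`, so it is equivalent to `w`; hence `w` adds just that
element. -/
theorem countable_covers (hT : T₀.IsFullBinary) (p : QForcing F T₀) : {w | w ⋖ p}.Countable := by
  refine (countable_iUnion fun n => (boundedExt_finite hT p n).countable).mono fun w hw => ?_
  have hne : ∃ i, ∃ x ∈ (w i).tree.carrier, x ∉ (p i).tree.carrier := by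
    by_contra! hcon
    exact hw.1.2 fun i => (PForcing.eq_of_le_of_subset hT (hw.1.1 i) (hcon i)).ge
  obtain ⟨i, x, hxw, hxp⟩ := hne
  set c : QForcing F T₀ := fun j => PForcing.restr hT (hw.1.1 j)
    {y | y ∈ (p j).tree.carrier ∨ (j = i ∧ y = x)} fun y hy => .inl hy with hc
  have hcp : c < p := ⟨fun j => PForcing.restr_le .., fun h => hxp
    (PForcing.carrier_subset (h i) ⟨hxw, .inr ⟨rfl, rfl⟩⟩)⟩
  have hwc : w ≤ c := fun j => PForcing.le_restr ..
  have hcw : c ≤ w := by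
    by_contra h
    exact hw.2 ⟨hwc, h⟩ hcp
  refine mem_iUnion.2 ⟨max i x + 1, hw.1.1, fun j y hy => ?_⟩
  rcases (PForcing.carrier_subset (hcw j) hy).2 with h | ⟨rfl, rfl⟩
  · exact .inl h
  · exact .inr (by omega)

/-- All numbers `< n` belong to the first `n` trees of `r`. -/
def Total (n : ℕ) (r : QForcing F T₀) : Prop := ∀ i < n, ∀ x < n, x ∈ (r i).tree.carrier

/-- Each `o` is a guess at what a total condition contains in the `n × n` box. For a guess
compatible with `q`, a common extension is pushed to some `d` in `D`, and everything of `d` except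
its new elements in the box is added to `q`. A total `o` supplies the missing part, so `r` below
both lies below `d`. -/
theorem exists_predense_aux (hT : T₀.IsFullBinary) {p : QForcing F T₀} {n : ℕ}
    {D : Set (QForcing F T₀)} (hD : ∀ q, ∃ d ≤ q, d ∈ D) (s : Finset (QForcing F T₀))
    (hs : ∀ o ∈ s, o ≤ p) : ∃ q, LeAt n q p ∧ ∃ E : Finset (QForcing F T₀), E.card ≤ s.card ∧
      ↑E ⊆ D ∧ ∀ r ≤ q, Total n r → ∀ o ∈ s, Total n o → r ≤ o → ∃ e ∈ E, r ≤ e := by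
  classical
  induction s using Finset.induction_on with
  | empty => exact ⟨p, ⟨le_rfl, fun _ _ _ _ h => h⟩, ∅, by simp⟩
  | insert o s hos ih =>
    obtain ⟨q, hq, E, hE, hED, hqE⟩ := ih fun o' ho' => hs o' (Finset.mem_insert_of_mem ho')
    have hop := hs o (Finset.mem_insert_self o s)
    rw [Finset.card_insert_of_notMem hos]
    by_cases hcom : ∃ a ≤ q, a ≤ o
    swap
    · refine ⟨q, hq, E, by omega, hED, fun r hr htr o' ho' hto hro => ?_⟩
      rcases Finset.mem_insert.1 ho' with rfl | ho'
      · exact absurd ⟨r, hr, hro⟩ hcom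
      · exact hqE r hr htr o' ho' hto hro
    obtain ⟨a, haq, hao⟩ := hcom
    obtain ⟨d, hda, hdD⟩ := hD a
    have hdq := hda.trans haq
    set q' : QForcing F T₀ := fun i => PForcing.restr hT (hdq i)
      {y | y ∈ (q i).tree.carrier ∨ ¬ (i < n ∧ y < n)} fun y hy => .inl hy with hq'
    have hq'q : q' ≤ q := fun j => PForcing.restr_le ..
    have hdq' : d ≤ q' := fun j => PForcing.le_restr ..
    refine ⟨q', LeAt.trans ⟨hq'q, fun i hi x hx hxq => hxq.2.resolve_right fun h => h ⟨hi, hx⟩⟩ hq,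
      insert d E, (Finset.card_insert_le _ _).trans (by omega), ?_, fun r hr htr o' ho' hto hro => ?_⟩
    · rw [Finset.coe_insert]
      exact insert_subset hdD hED
    rcases Finset.mem_insert.1 ho' with rfl | ho'
    · refine ⟨d, Finset.mem_insert_self _ _, fun i => PForcing.le_of_upper_eq hT
        (hr.trans (hq'q.trans hq.1) i) (hdq.trans hq.1 i) fun y hy => ?_⟩
      -- Two extensions `r` and `d` of one condition `c ≤ p` agree about every element of `c`. This
      -- is applied with `o'` inside the box and `q'` outside it.
      have common : ∀ c : QForcing F T₀, c ≤ p → r ≤ c → d ≤ c → y ∈ (c i).tree.carrier →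
          y ∈ (r i).tree.carrier ∧ (r i).tree.upper (p i).tree.carrier y =
          (d i).tree.upper (p i).tree.carrier y ∧ (r i).eval y = (d i).eval y := by
        intro c hcp hrc hdc hyc
        exact ⟨PForcing.carrier_subset (hrc i) hyc,
          (PForcing.upper_eq (hrc i) (hcp i) hyc).trans (PForcing.upper_eq (hdc i) (hcp i) hyc).symm,
          (PForcing.eval_eq hT (hrc i) hyc).trans (PForcing.eval_eq hT (hdc i) hyc).symm⟩
      by_cases hyn : i < n ∧ y < n
      · exact common o' hop hro (hda.trans hao) (hto i hyn.1 y hyn.2)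
      · exact common q' (hq'q.trans hq.1) hr hdq' ⟨hy, .inr hyn⟩
    · obtain ⟨e, he, hre⟩ := hqE r (hr.trans hq'q) htr o' ho' hto hro
      exact ⟨e, Finset.mem_insert_of_mem he, hre⟩

/-- The bound counts the elements of `boundedExt p n` and precedes the choice of `D`, which the
PP-property needs. Any `r` extends to a total condition, whose restriction to `p` and the box is one
of the guesses. -/
theorem exists_predense (hF : F ≤ cofinite) (hT : T₀.IsFullBinary) (p : QForcing F T₀) (n : ℕ) :
    ∃ B : ℕ, ∀ D : Set (QForcing F T₀), (∀ q, ∃ d ≤ q, d ∈ D) → ∃ q, LeAt n q p ∧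
      ∃ E : Finset (QForcing F T₀), E.card ≤ B ∧ ↑E ⊆ D ∧ ∀ r ≤ q, ∃ e ∈ E, Compat e r := by
  refine ⟨(boundedExt_finite hT p n).toFinset.card, fun D hD => ?_⟩
  obtain ⟨q, hq, E, hE, hED, h⟩ := exists_predense_aux (n := n) hT hD
    (boundedExt_finite hT p n).toFinset fun o ho => ((Finite.mem_toFinset _).1 ho).1
  refine ⟨q, hq, E, hE, hED, fun r hr => ?_⟩
  choose f hf hf' using fun i => (r i).exists_total_le hF hT n
  have hfr : f ≤ r := hf
  have hfp : f ≤ p := hfr.trans (hr.trans hq.1)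
  set o : QForcing F T₀ := fun i => PForcing.restr hT (hfp i)
      {y | y ∈ (p i).tree.carrier ∨ (i < n ∧ y < n)} fun y hy => .inl hy with ho
  obtain ⟨e, he, hfe⟩ := h f (hfr.trans hr) (fun i _ x hx => hf' i x hx) o
    ((Finite.mem_toFinset _).2 ⟨fun j => PForcing.restr_le .., fun i x hx => hx.2⟩)
    (fun i hi x hx => ⟨hf' i x hx, .inr ⟨hi, hx⟩⟩) fun j => PForcing.le_restr ..
  exact ⟨e, he, f, hfe, hfr⟩

end QForcing
end CccForcing

/-! ### Non-meagerness of the filter, existence of base trees, and fusion. -/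

namespace CccForcing

/-- The codes of the finite initial segments of `x`. -/
def segCodes (x : ℕ → Bool) : Set ℕ := range fun n => Encodable.encode ((List.range n).map x)

theorem segCodes_infinite (x : ℕ → Bool) : (segCodes x).Infinite :=
  infinite_range_of_injective fun m n h => by
    simpa using congrArg List.length (Encodable.encode_injective h)

theorem segCodes_inter_finite {x y : ℕ → Bool} (h : x ≠ y) :
    (segCodes x ∩ segCodes y).Finite := by
  obtain ⟨k, hk⟩ := Function.ne_iff.1 h
  refine ((finite_Iic k).image fun n => Encodable.encode ((List.range n).map x)).subset ?_
  rintro _ ⟨⟨n, rfl⟩, ⟨m, hm⟩⟩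
  refine ⟨n, ?_, rfl⟩
  by_contra hn
  have h1 := Encodable.encode_injective hm
  have h2 : m = n := by simpa using congrArg List.length h1
  subst h2
  have h3 := List.map_inj_left.1 h1 k (by simpa using hn)
  exact hk h3.symm

/-- A ccc filter is not meager: for each partition of `ω` into finite intervals, some set in the
filter misses infinitely many of them. -/
theorem IsCccPFilter.exists_inter_Ico_eq_empty {F : Filter ℕ} (hF : IsCccPFilter F) {m : ℕ → ℕ}
    (hm : StrictMono m) : ∃ B ∈ F, {i | B ∩ Ico (m i) (m (i + 1)) = ∅}.Infinite := by
  by_contra! hcon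
  -- The branches of the binary tree index an almost disjoint family of sets of intervals; `X x` is
  -- the union of the intervals on the branch `x`.
  set X : (ℕ → Bool) → Set ℕ := fun x => ⋃ i ∈ segCodes x, Ico (m i) (m (i + 1)) with hX
  have hdisj : ∀ i j, i ≠ j → Disjoint (Ico (m i) (m (i + 1))) (Ico (m j) (m (j + 1))) :=
    fun i j hij => hm.monotone.pairwise_disjoint_on_Ico_succ hij
  -- The complement of `X x` misses infinitely many intervals, so it is not in `F` under the
  -- assumption being refuted.
  have hpos : ∀ x, (X x)ᶜ ∉ F := by
    intro x hx
    refine segCodes_infinite x ((hcon _ hx).subset fun i hi => ?_)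
    rw [mem_ofPred_eq, ← disjoint_iff_inter_eq_empty, disjoint_compl_left_iff_subset]
    exact subset_biUnion_of_mem (u := fun i => Ico (m i) (m (i + 1))) hi
  have hinter : ∀ x y, x ≠ y → (X x ∩ X y)ᶜ ∈ F := by
    intro x y hxy
    refine hF.le_cofinite (Finite.compl_mem_cofinite ?_)
    refine ((segCodes_inter_finite hxy).biUnion fun i _ => finite_Ico (m i) (m (i + 1))).subset ?_
    rintro z ⟨hzx, hzy⟩
    obtain ⟨i, hi, hzi⟩ := mem_iUnion₂.1 hzx
    obtain ⟨j, hj, hzj⟩ := mem_iUnion₂.1 hzy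
    obtain rfl : i = j := by
      by_contra hij
      exact disjoint_left.1 (hdisj i j hij) hzi hzj
    exact mem_biUnion ⟨hi, hj⟩ hzi
  have hinj : Function.Injective X := by
    intro x y hxy
    by_contra hne
    have := hinter x y hne
    rw [hxy, inter_self] at this
    exact hpos y this
  have hc := hF.ccc (range X) (by rintro _ ⟨x, rfl⟩; exact hpos x) (by
    rintro _ ⟨x, rfl⟩ _ ⟨y, rfl⟩ hne
    exact hinter x y fun h => hne (h ▸ rfl))
  have : Countable (ℕ → Bool) := by
    have := hc.to_subtype
    exact (Equiv.ofInjective X hinj).countable_iff.2 this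
  obtain ⟨f, hf⟩ := exists_surjective_nat (ℕ → Bool)
  obtain ⟨n, hn⟩ := hf fun n => !f n n
  simpa using congrFun hn n

/-- A numbering of the nodes of the binary tree compatible with its order. -/
def binaryCode (l : List Bool) : ℕ := l.foldl (fun a b => 2 * a + b.toNat) 1

theorem binaryCode_concat (l : List Bool) (b : Bool) :
    binaryCode (l ++ [b]) = 2 * binaryCode l + b.toNat := by simp [binaryCode]

theorem binaryCode_pos (l : List Bool) : 0 < binaryCode l := by
  induction l using List.reverseRecOn with
  | nil => simp [binaryCode]
  | append_singleton l b ih => rw [binaryCode_concat]; omega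

theorem binaryCode_injective : Function.Injective binaryCode := by
  intro l
  induction l using List.reverseRecOn with
  | nil =>
    intro l' h
    rcases List.eq_nil_or_concat l' with rfl | ⟨l'', b, rfl⟩
    · rfl
    · have := binaryCode_pos l''
      rw [List.concat_eq_append, binaryCode_concat] at h
      change 1 = _ at h
      omega
  | append_singleton l b ih =>
    intro l' h
    rcases List.eq_nil_or_concat l' with rfl | ⟨l'', b', rfl⟩
    · have := binaryCode_pos l
      rw [binaryCode_concat] at h
      change _ = 1 at h
      omega
    · rw [List.concat_eq_append, binaryCode_concat, binaryCode_concat] at h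
      have hb := b.toNat_lt
      have hb' := b'.toNat_lt
      rw [List.concat_eq_append, ih (show binaryCode l = binaryCode l'' by omega)]
      congr 2
      have : b.toNat = b'.toNat := by omega
      revert this
      cases b <;> cases b' <;> simp

theorem binaryCode_mono {l l' : List Bool} (h : l <+: l') : binaryCode l ≤ binaryCode l' := by
  obtain ⟨t, rfl⟩ := h
  induction t using List.reverseRecOn with
  | nil => simp
  | append_singleton t b ih => rw [← List.append_assoc, binaryCode_concat]; omega

/-- The node `l` is placed at the element of `X` with index `binaryCode l`; since codes grow along
the tree, its order respects that of the numbers. -/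
theorem exists_isFullBinary {X : Set ℕ} (hX : X.Infinite) :
    ∃ T : NatTree, T.carrier ⊆ X ∧ T.IsFullBinary := by
  set g : List Bool → ℕ := fun l => Nat.nth (· ∈ X) (binaryCode l) with hg
  have hmono := Nat.nth_strictMono (p := (· ∈ X)) hX
  have hinj : Function.Injective g := hmono.injective.comp binaryCode_injective
  refine ⟨⟨range g, fun i j => ∃ l l', g l = i ∧ g l' = j ∧ l <+: l', ?_, ?_, ?_, ?_, ?_⟩, ?_,
    (Equiv.ofInjective g hinj).symm, ?_⟩
  · rintro _ _ ⟨l, l', rfl, rfl, -⟩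
    exact ⟨⟨l, rfl⟩, l', rfl⟩
  · rintro _ ⟨l, rfl⟩
    exact ⟨l, l, rfl, rfl, List.prefix_rfl⟩
  · rintro _ _ _ ⟨l, l', rfl, rfl, h⟩ ⟨l1, l2, h1, rfl, h'⟩
    exact ⟨l, l2, rfl, rfl, h.trans (hinj h1 ▸ h')⟩
  · rintro _ _ _ ⟨l, l', rfl, rfl, h⟩ ⟨l1, l2, rfl, h1, h'⟩
    exact (List.prefix_or_prefix_of_prefix h (hinj h1 ▸ h')).imp (fun h => ⟨_, _, rfl, rfl, h⟩)
      (fun h => ⟨_, _, rfl, rfl, h⟩)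
  · rintro _ _ ⟨l, l', rfl, rfl, h⟩
    exact hmono.monotone (binaryCode_mono h)
  · rintro _ ⟨l, rfl⟩
    exact Nat.nth_mem_of_infinite (p := (· ∈ X)) hX _
  · rintro ⟨_, l, rfl⟩ ⟨_, l', rfl⟩
    have hl : ∀ l, (Equiv.ofInjective g hinj).symm ⟨g l, l, rfl⟩ = l := fun l =>
      Equiv.ofInjective_symm_apply hinj l
    rw [hl, hl]
    constructor
    · rintro ⟨l1, l2, h1, h2, h⟩
      rwa [← hinj h1, ← hinj h2]
    · exact fun h => ⟨l, l', rfl, rfl, h⟩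

/-- For the partition into singletons, non-meagerness yields a member of `F` with infinite
complement, which has room for a binary tree. -/
theorem IsCccPFilter.exists_baseTree {F : Filter ℕ} (hF : IsCccPFilter F) :
    ∃ T₀ : NatTree, IsBaseTree F T₀ := by
  obtain ⟨B, hB, hinf⟩ := hF.exists_inter_Ico_eq_empty strictMono_id
  have hX : Bᶜ.Infinite := by
    refine hinf.mono fun i hi hiB => ?_
    have : i ∈ B ∩ Ico (id i) (id (i + 1)) := ⟨hiB, by simp⟩
    rw [hi] at this
    exact this
  obtain ⟨T, hT, hT'⟩ := exists_isFullBinary hX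
  exact ⟨T, mem_of_superset hB (subset_compl_comm.1 hT), hT'⟩

namespace PForcing

variable {F : Filter ℕ} {T₀ : NatTree}

/-- A descending sequence of conditions whose trees have union in the dual ideal has a lower
bound, obtained by taking unions. -/
theorem exists_iUnion (hT : T₀.IsFullBinary) {p : ℕ → PForcing F T₀} (hp : Antitone p)
    (h : (⋃ k, (p k).tree.carrier)ᶜ ∈ F) :
    ∃ q, (∀ k, q ≤ p k) ∧ q.tree.carrier = ⋃ k, (p k).tree.carrier := by
  classical
  have hmono : ∀ {k l i j}, k ≤ l → (p k).tree.le i j → (p l).tree.le i j := by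
    intro k l i j hkl hij
    have hm := (p k).tree.mem_of_le hij
    exact ((hp hkl).1.2.1 i hm.1 j hm.2).1 hij
  let T : NatTree :=
    { carrier := ⋃ k, (p k).tree.carrier
      le := fun i j => ∃ k, (p k).tree.le i j
      mem_of_le := fun ⟨k, h⟩ => ⟨mem_iUnion.2 ⟨k, ((p k).tree.mem_of_le h).1⟩,
        mem_iUnion.2 ⟨k, ((p k).tree.mem_of_le h).2⟩⟩
      refl := fun h => (mem_iUnion.1 h).imp fun k hk => (p k).tree.refl hk
      trans := fun ⟨k, h⟩ ⟨l, h'⟩ => ⟨max k l, (p (max k l)).tree.trans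
        (hmono (le_max_left _ _) h) (hmono (le_max_right _ _) h')⟩
      linear_below := fun ⟨k, h⟩ ⟨l, h'⟩ => ((p (max k l)).tree.linear_below
        (hmono (le_max_left _ _) h) (hmono (le_max_right _ _) h')).imp
          (fun h => ⟨_, h⟩) (fun h => ⟨_, h⟩)
      le_nat := fun ⟨k, h⟩ => (p k).tree.le_nat h }
  have hTp : ∀ k, T.CofExt (p k).tree := by
    refine fun k => ⟨subset_iUnion (fun k => (p k).tree.carrier) k, fun i hi j hj =>
      ⟨fun h => ⟨k, h⟩, fun ⟨l, h⟩ => ?_⟩, fun t ht => ?_⟩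
    · exact ((hp (le_max_left k l)).1.2.1 i hi j hj).2 (hmono (le_max_right _ _) h)
    · obtain ⟨l, hl⟩ := mem_iUnion.1 ht
      obtain ⟨s, hs, hts⟩ := (hp (le_max_left k l)).1.cofExt.2.2 t
        (carrier_subset (hp (le_max_right k l)) hl)
      exact ⟨s, hs, _, hts⟩
  have hex : ∀ i, ∃ v, ∀ k, i ∈ (p k).tree.carrier → (p k).eval i = v := by
    intro i
    by_cases hi : ∃ k, i ∈ (p k).tree.carrier
    · obtain ⟨k, hk⟩ := hi
      refine ⟨(p k).eval i, fun l hl => ?_⟩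
      rw [← eval_eq hT (hp (le_max_left k l)) hk, eval_eq hT (hp (le_max_right k l)) hl]
    · exact ⟨false, fun k hk => absurd ⟨k, hk⟩ hi⟩
  choose f hf using hex
  refine ⟨ofExt hT (p 0) T h (hTp 0) f, fun k => (le_iff hT).2 ⟨hTp k, fun i hi => ?_⟩, rfl⟩
  rw [eval_ofExt _ _ _ _ _ ((hTp k).1 hi), hf i k hi]

end PForcing

namespace QForcing

variable {F : Filter ℕ} {T₀ : NatTree}

theorem finite_lists (M : ℕ) : {l : List ℕ | l.length ≤ M ∧ ∀ x ∈ l, x ≤ M}.Finite := by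
  refine ((List.finite_length_le (Fin (M + 1)) M).image (List.map Fin.val)).subset fun l hl => ?_
  refine ⟨l.map (Fin.ofNat (M + 1)), by simpa using hl.1, ?_⟩
  rw [List.map_map]
  conv_rhs => rw [← List.map_id l]
  refine List.map_congr_left fun x hx => ?_
  simpa [Fin.ofNat] using Nat.mod_eq_of_lt (Nat.lt_succ_iff.2 (hl.2 x hx))

/-- The fusion game: if at each stage, for each number `n`, the construction can be continued by some
`q` with `LeAt n q p`, then some infinite run of the construction has a lower bound. -/
theorem exists_fusion (hF : IsCccPFilter F) (hT : T₀.IsFullBinary)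
    (X : ℕ → QForcing F T₀ → Prop) (p₀ : QForcing F T₀) (h0 : X 0 p₀)
    (hstep : ∀ k p n, X k p → ∃ q, LeAt n q p ∧ X (k + 1) q) (n₀ : ℕ) :
    ∃ q, LeAt n₀ q p₀ ∧ ∀ k, ∃ p, X k p ∧ q ≤ p := by
  choose! σ hσ hσX using hstep
  -- Positions of the game are indexed by the finite list of moves `n`, latest first. There are only
  -- countably many, so one set `A` in `F` is almost disjoint from all their trees.
  let pos : List ℕ → QForcing F T₀ := fun l => l.rec p₀ fun n l p => σ l.length p n
  have hpos : ∀ l, X l.length (pos l) := fun l => by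
    induction l with
    | nil => exact h0
    | cons n l ih => exact hσX _ _ _ ih
  obtain ⟨A, hA, hAfin⟩ : ∃ A ∈ F, ∀ l i, (A ∩ (pos l i).tree.carrier).Finite := by
    obtain ⟨A, hA, h⟩ := hF.pseudoInter
      (fun c => match (Encodable.decode c : Option (List ℕ × ℕ)) with
        | some z => ((pos z.1 z.2).tree.carrier)ᶜ
        | none => univ)
      (fun c => by
        rcases (Encodable.decode c : Option (List ℕ × ℕ)) with _ | z
        · exact univ_mem
        · exact (pos z.1 z.2).compl_mem)
    refine ⟨A, hA, fun l i => ?_⟩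
    have := h (Encodable.encode (l, i))
    simpa [sdiff_compl] using this
  have hg : ∀ M, ∃ b, ∀ l : List ℕ, l.length ≤ M → (∀ x ∈ l, x ≤ M) → ∀ i ≤ M,
      ∀ x ∈ A ∩ (pos l i).tree.carrier, x < b := by
    intro M
    have hfin := (finite_lists M).biUnion fun l _ => (finite_Iic M).biUnion fun i _ => hAfin l i
    obtain ⟨b, hb⟩ := hfin.bddAbove
    exact ⟨b + 1, fun l hl hl' i hi x hx => Nat.lt_succ_iff.2
      (hb (mem_biUnion (x := l) ⟨hl, hl'⟩ (mem_biUnion (x := i) hi hx)))⟩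
  choose g hg using hg
  -- Each interval reaches past all elements of `A` in the relevant trees of positions played with
  -- moves up to its left end. The shift `a + 1` allows for lists one longer than the index of their
  -- last move, and starting at `n₀` keeps every move at least `n₀`.
  let m : ℕ → ℕ := fun i => i.rec n₀ fun _ a => max (a + 1) (g (a + 1))
  have hm1 : ∀ i, m i + 1 ≤ m (i + 1) := fun i => le_max_left _ _
  have hmg : ∀ i, g (m i + 1) ≤ m (i + 1) := fun i => le_max_right _ _
  have hm : StrictMono m := strictMono_nat_of_lt_succ hm1
  obtain ⟨B, hB, hinf⟩ := hF.exists_inter_Ico_eq_empty hm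
  obtain ⟨j, hj, hjB⟩ : ∃ j : ℕ → ℕ, StrictMono j ∧ ∀ k, B ∩ Ico (m (j k)) (m (j k + 1)) = ∅ :=
    ⟨_, Nat.nth_strictMono hinf, fun k => Nat.nth_mem_of_infinite hinf k⟩
  -- The moves are the left ends of intervals missed by `B`.
  let n : ℕ → ℕ := fun k => m (j k)
  have hn : StrictMono n := hm.comp hj
  let L : ℕ → List ℕ := fun k => k.rec [] fun k l => n k :: l
  have hL : ∀ k, L (k + 1) = n k :: L k := fun k => rfl
  have hLlen : ∀ k, (L k).length = k := fun k => by
    induction k with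
    | zero => rfl
    | succ k ih => rw [hL, List.length_cons, ih]
  have hLn : ∀ k, ∀ x ∈ L (k + 1), x ≤ n k := fun k => by
    induction k with
    | zero => simp [L]
    | succ k ih =>
      intro x hx
      rw [hL, List.mem_cons] at hx
      rcases hx with rfl | hx
      · exact le_rfl
      · exact (ih x hx).trans (hn.monotone k.le_succ)
  let P : ℕ → QForcing F T₀ := fun k => pos (L k)
  have hP : ∀ k, LeAt (n k) (P (k + 1)) (P k) := fun k => by
    have := hσ _ _ (n k) (hpos (L k))
    exact this
  have hPX : ∀ k, X k (P k) := fun k => by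
    have := hpos (L k)
    rwa [hLlen] at this
  have hPanti : Antitone P := antitone_nat_of_succ_le fun k => (hP k).1
  have hnk : ∀ k, k ≤ n k := hn.id_le
  -- A new `x` is not below `n k` by `LeAt`, not in the interval starting at `n k` because `B`
  -- misses it, and not beyond it by the growth of `m`.
  have hnew : ∀ i k, i < k → ∀ x ∈ A ∩ B, x ∈ (P (k + 1) i).tree.carrier →
      x ∈ (P k i).tree.carrier := by
    intro i k hik x hx hxP
    have hk := hnk k
    by_contra hcon
    have h1 : m (j k + 1) ≤ x := by
      by_contra hlt
      have hnx : n k ≤ x := by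
        by_contra h
        exact hcon ((hP k).2 i (hik.trans_le hk) x (not_le.1 h) hxP)
      have : x ∈ B ∩ Ico (m (j k)) (m (j k + 1)) := ⟨hx.2, hnx, not_le.1 hlt⟩
      rw [hjB k] at this
      exact this
    have h2 := hg (n k + 1) (L (k + 1)) ((hLlen (k + 1)).trans_le (Nat.succ_le_succ hk))
      (fun x hx => (hLn k x hx).trans (Nat.le_succ _)) i (by omega) x ⟨hx.1, hxP⟩
    exact absurd (h2.trans_le (hmg (j k))) (not_lt.2 h1)
  -- On `A ∩ B` the tree in coordinate `i` stops growing at stage `i + 1`, where its intersection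
  -- with `A` is finite.
  have hunion : ∀ i, (⋃ k, (P k i).tree.carrier)ᶜ ∈ F := by
    intro i
    have hall : ∀ k, ∀ x ∈ A ∩ B, x ∈ (P k i).tree.carrier → x ∈ (P (i + 1) i).tree.carrier := by
      intro k x hx hxk
      rcases le_total k (i + 1) with h | h
      · exact PForcing.carrier_subset (hPanti h i) hxk
      · induction k, h using Nat.le_induction with
        | base => exact hxk
        | succ k hk ih => exact ih (hnew i k hk x hx hxk)
    refine mem_of_superset (inter_mem (inter_mem hA hB)
      (hF.le_cofinite (hAfin (L (i + 1)) i).compl_mem_cofinite)) ?_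
    rintro x ⟨hx, hx'⟩ hxU
    obtain ⟨k, hk⟩ := mem_iUnion.1 hxU
    exact hx' ⟨hx.1, hall k x hx hk⟩
  choose q hq hqU using fun i => PForcing.exists_iUnion hT (p := fun k => P k i)
    (fun k l h => hPanti h i) (hunion i)
  refine ⟨q, ⟨fun i => hq i 0, fun i hi x hx hxq => ?_⟩, fun k => ⟨P k, hPX k, fun i => hq i k⟩⟩
  rw [hqU] at hxq
  obtain ⟨k, hk⟩ := mem_iUnion.1 hxq
  have hnn : n₀ ≤ n 0 := hm.monotone (Nat.zero_le _)
  induction k with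
  | zero => exact hk
  | succ k ih =>
    have := hnn.trans (hn.monotone k.zero_le)
    exact ih ((hP k).2 i (by omega) x (by omega) hk)

end QForcing
end CccForcing

/-! ### Definability over `H(κ)` and reflection to elementary submodels. -/

namespace CccForcing

open FirstOrder FirstOrder.Language

theorem InH.mem {κ : Cardinal.{0}} {x y : ZFSet.{0}} (h : InH κ x) (hy : y ∈ x) : InH κ y := by
  obtain ⟨t, ht, hx, hc⟩ := h
  exact ⟨t, ht, ht.subset_of_mem (hx hy), hc⟩

/-! ### First-order definable relations on `H(κ)` -/

section Definability

variable {κ : Cardinal.{0}} {α β γ : Type}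

/-- The relation `φ` is first-order definable over `H(κ)`. -/
def Dfn (φ : (α → H κ) → Prop) : Prop := ∃ ψ : setLang.Formula α, ∀ v, ψ.Realize v ↔ φ v

namespace Dfn

theorem congr {φ φ' : (α → H κ) → Prop} (h : Dfn φ) (h' : ∀ v, φ v ↔ φ' v) : Dfn φ' :=
  h.imp fun _ hψ v => (hψ v).trans (h' v)

theorem mem (a b : α) : Dfn fun v : α → H κ => (v a).1 ∈ (v b).1 :=
  ⟨Relations.formula₂ (L := setLang) SetRel.mem (.var a) (.var b), fun _ =>
    Formula.realize_rel₂.trans Iff.rfl⟩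

theorem eq (a b : α) : Dfn fun v : α → H κ => v a = v b :=
  ⟨(Term.var a).equal (.var b), fun _ => Formula.realize_equal⟩

theorem and {φ φ' : (α → H κ) → Prop} (h : Dfn φ) (h' : Dfn φ') : Dfn fun v => φ v ∧ φ' v := by
  obtain ⟨ψ, hψ⟩ := h
  obtain ⟨ψ', hψ'⟩ := h'
  exact ⟨ψ ⊓ ψ', fun v => by rw [Formula.realize_inf, hψ, hψ']⟩

theorem not {φ : (α → H κ) → Prop} (h : Dfn φ) : Dfn fun v => ¬ φ v := by
  obtain ⟨ψ, hψ⟩ := h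
  exact ⟨ψ.not, fun v => by rw [Formula.realize_not, hψ]⟩

theorem or {φ φ' : (α → H κ) → Prop} (h : Dfn φ) (h' : Dfn φ') : Dfn fun v => φ v ∨ φ' v :=
  (h.not.and h'.not).not.congr fun _ => by tauto

theorem imp {φ φ' : (α → H κ) → Prop} (h : Dfn φ) (h' : Dfn φ') : Dfn fun v => φ v → φ' v :=
  (h.and h'.not).not.congr fun _ => by tauto

theorem iff {φ φ' : (α → H κ) → Prop} (h : Dfn φ) (h' : Dfn φ') : Dfn fun v => φ v ↔ φ' v :=
  ((h.imp h').and (h'.imp h)).congr fun _ => by tauto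

theorem forall_finite [Finite γ] {φ : γ → (α → H κ) → Prop} (h : ∀ g, Dfn (φ g)) :
    Dfn fun v => ∀ g, φ g v := by
  choose ψ hψ using h
  exact ⟨Formula.iInf ψ, fun v => by simp [Formula.realize_iInf, hψ]⟩

theorem relabel {φ : (α → H κ) → Prop} (h : Dfn φ) (g : α → β) :
    Dfn fun v : β → H κ => φ fun a => v (g a) := by
  obtain ⟨ψ, hψ⟩ := h
  exact ⟨Formula.relabel g ψ, fun v => by rw [Formula.realize_relabel, hψ]; rfl⟩

theorem exs [Finite γ] {φ : (α → H κ) → (γ → H κ) → Prop}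
    (h : Dfn fun v : α ⊕ γ → H κ => φ (fun a => v (.inl a)) fun g => v (.inr g)) :
    Dfn fun v => ∃ x, φ v x := by
  obtain ⟨ψ, hψ⟩ := h
  exact ⟨ψ.iExs γ, fun v => by simp [Formula.realize_iExs, hψ]⟩

theorem ex {φ : (α → H κ) → H κ → Prop}
    (h : Dfn fun v : α ⊕ Unit → H κ => φ (fun a => v (.inl a)) (v (.inr ()))) :
    Dfn fun v => ∃ x, φ v x :=
  (exs (γ := Unit) (φ := fun v x => φ v (x ())) h).congr fun _ =>
    ⟨fun ⟨x, hx⟩ => ⟨x (), hx⟩, fun ⟨x, hx⟩ => ⟨fun _ => x, hx⟩⟩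

theorem all {φ : (α → H κ) → H κ → Prop}
    (h : Dfn fun v : α ⊕ Unit → H κ => φ (fun a => v (.inl a)) (v (.inr ()))) :
    Dfn fun v => ∀ x, φ v x :=
  (ex (φ := fun v x => ¬ φ v x) h.not).not.congr fun _ => by simp

end Dfn

/-- Transitivity of `H(κ)` makes quantification over its elements see all members of `z`. -/
theorem H.unordered_pair_iff {x y z : H κ} :
    (∀ w : H κ, w.1 ∈ z.1 ↔ w = x ∨ w = y) ↔ z.1 = {x.1, y.1} := by
  constructor
  · intro h
    ext w
    rw [ZFSet.mem_pair]
    constructor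
    · exact fun hw => ((h ⟨w, z.2.mem hw⟩).1 hw).imp (congrArg Subtype.val) (congrArg Subtype.val)
    · rintro (rfl | rfl)
      exacts [(h x).2 (.inl rfl), (h y).2 (.inr rfl)]
  · intro h w
    rw [h, ZFSet.mem_pair]
    exact or_congr Subtype.ext_iff.symm Subtype.ext_iff.symm

theorem Dfn.unordered_pair (a b d : α) :
    Dfn fun v : α → H κ => (v a).1 = {(v b).1, (v d).1} :=
  (Dfn.all (φ := fun v w => w.1 ∈ (v a).1 ↔ w = v b ∨ w = v d)
    ((Dfn.mem _ _).iff ((Dfn.eq _ _).or (Dfn.eq _ _)))).congr fun _ => H.unordered_pair_iff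

theorem Dfn.pair (a b d : α) : Dfn fun v : α → H κ => (v a).1 = ZFSet.pair (v b).1 (v d).1 := by
  have : Dfn fun v : α → H κ => ∃ s t : H κ, (v a).1 = {s.1, t.1} ∧ s.1 = {(v b).1, (v b).1} ∧
      t.1 = {(v b).1, (v d).1} :=
    Dfn.ex (Dfn.ex ((Dfn.unordered_pair _ _ _).and
      ((Dfn.unordered_pair _ _ _).and (Dfn.unordered_pair _ _ _))))
  refine this.congr fun v => ?_
  have hp : ∀ x y : ZFSet.{0}, ZFSet.pair x y = {{x, x}, {x, y}} := fun x y => by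
    rw [ZFSet.pair_eq_singleton]; rfl
  rw [hp]
  constructor
  · rintro ⟨s, t, h, hs, ht⟩
    rw [h, hs, ht]
  · intro h
    exact ⟨⟨_, (v a).2.mem (h ▸ ZFSet.mem_pair.2 (.inl rfl))⟩,
      ⟨_, (v a).2.mem (h ▸ ZFSet.mem_pair.2 (.inr rfl))⟩, h, rfl, rfl⟩

/-- Existential statements true in `H(κ)` have witnesses in elementary submodels. -/
theorem Dfn.exists_mem [Finite γ] {φ : (α → H κ) → (γ → H κ) → Prop}
    (h : Dfn fun v : α ⊕ γ → H κ => φ (fun a => v (.inl a)) fun g => v (.inr g))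
    (S : setLang.ElementarySubstructure (H κ)) {v : α → H κ} (hv : ∀ a, v a ∈ S)
    (hex : ∃ x, φ v x) : ∃ x, (∀ g, x g ∈ S) ∧ φ v x := by
  obtain ⟨ψ, hψ⟩ := h
  have h1 : (ψ.iExs γ).Realize v := by
    obtain ⟨x, hx⟩ := hex
    exact Formula.realize_iExs.2 ⟨x, (hψ _).2 hx⟩
  have h2 := (S.subtype.map_formula (ψ.iExs γ) fun a => ⟨v a, hv a⟩).1 h1
  obtain ⟨x, hx⟩ := Formula.realize_iExs.1 h2
  have h3 := (S.subtype.map_formula ψ _).2 hx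
  exact ⟨fun g => x g, fun g => (x g).2, (hψ _).1 h3⟩

end Definability

/-! ### Definability over `H(κ)` from a forcing -/

section ForcingDefinability

variable {P : Type} [Preorder P] {c : SetCoding P} {κ : Cardinal.{0}} {α β γ : Type}

theorem SetCoding.inH_carrier (hc : InH κ c.poset) : InH κ c.carrier := by
  have h : InH κ {c.carrier, c.rel} := hc.mem (ZFSet.mem_pair.2 (.inr rfl))
  exact h.mem (ZFSet.mem_pair.2 (.inl rfl))

theorem SetCoding.inH_rel (hc : InH κ c.poset) : InH κ c.rel := by
  have h : InH κ {c.carrier, c.rel} := hc.mem (ZFSet.mem_pair.2 (.inr rfl))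
  exact h.mem (ZFSet.mem_pair.2 (.inr rfl))

/-- The code of a condition as an element of `H(κ)`. -/
noncomputable def SetCoding.codeH (hc : InH κ c.poset) (p : P) : H κ :=
  ⟨c.code p, (c.inH_carrier hc).mem ((c.mem_carrier _).2 ⟨p, rfl⟩)⟩

/-- The values of the variables, consisting of conditions, sets, and the forcing itself. -/
noncomputable def assign (hc : InH κ c.poset) (u : α → P) (v : β → H κ) : α ⊕ (β ⊕ Unit) → H κ :=
  Sum.elim (fun a => c.codeH hc (u a)) (Sum.elim v fun _ => ⟨c.poset, hc⟩)

/-- The relation `φ` between conditions and elements of `H(κ)` is definable over `H(κ)` from the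
forcing. -/
def PDfn (hc : InH κ c.poset) (φ : (α → P) → (β → H κ) → Prop) : Prop :=
  ∃ ψ : (α ⊕ (β ⊕ Unit) → H κ) → Prop, Dfn ψ ∧ ∀ u v, ψ (assign hc u v) ↔ φ u v

namespace PDfn

variable {hc : InH κ c.poset} {φ φ' : (α → P) → (β → H κ) → Prop}

theorem congr (h : PDfn hc φ) (h' : ∀ u v, φ u v ↔ φ' u v) : PDfn hc φ' :=
  h.imp fun _ hψ => ⟨hψ.1, fun u v => (hψ.2 u v).trans (h' u v)⟩

theorem mem (a b : β) : PDfn hc fun (_ : α → P) (v : β → H κ) => (v a).1 ∈ (v b).1 :=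
  ⟨_, Dfn.mem (.inr (.inl a)) (.inr (.inl b)), fun _ _ => Iff.rfl⟩

theorem eq (a b : β) : PDfn hc fun (_ : α → P) (v : β → H κ) => v a = v b :=
  ⟨_, Dfn.eq (.inr (.inl a)) (.inr (.inl b)), fun _ _ => Iff.rfl⟩

theorem pair (a b d : β) :
    PDfn hc fun (_ : α → P) (v : β → H κ) => (v a).1 = ZFSet.pair (v b).1 (v d).1 :=
  ⟨_, Dfn.pair (.inr (.inl a)) (.inr (.inl b)) (.inr (.inl d)), fun _ _ => Iff.rfl⟩

theorem code_mem (a : α) (b : β) :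
    PDfn hc fun (u : α → P) (v : β → H κ) => c.code (u a) ∈ (v b).1 :=
  ⟨_, Dfn.mem (.inl a) (.inr (.inl b)), fun _ _ => Iff.rfl⟩

theorem code_eq (a : α) (b : β) :
    PDfn hc fun (u : α → P) (v : β → H κ) => c.code (u a) = (v b).1 :=
  ⟨_, Dfn.eq (.inl a) (.inr (.inl b)), fun _ _ => Subtype.ext_iff⟩

/-- The order is read off the second component of the coded poset; this is the only access a model
has to the structure of the forcing. -/
theorem le (a b : α) : PDfn hc fun (u : α → P) (_ : β → H κ) => u a ≤ u b := by
  refine ⟨fun w => ∃ A L z : H κ, (w (.inr (.inr ()))).1 = ZFSet.pair A.1 L.1 ∧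
    z.1 ∈ L.1 ∧ z.1 = ZFSet.pair (w (.inl a)).1 (w (.inl b)).1,
    .ex (.ex (.ex ((Dfn.pair _ _ _).and ((Dfn.mem _ _).and (Dfn.pair _ _ _))))), fun u v => ?_⟩
  constructor
  · rintro ⟨A, L, z, h, hz, hz'⟩
    obtain ⟨-, hL⟩ := ZFSet.pair_inj.1 h
    rw [← hL] at hz
    obtain ⟨p, q, hpq, hz⟩ := (c.mem_rel _).1 hz
    obtain ⟨h1, h2⟩ := ZFSet.pair_inj.1 (hz'.symm.trans hz)
    rwa [c.code_injective h1, c.code_injective h2]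
  · intro h
    have hz := (c.mem_rel _).2 ⟨u a, u b, h, rfl⟩
    exact ⟨⟨_, c.inH_carrier hc⟩, ⟨_, c.inH_rel hc⟩, ⟨_, (c.inH_rel hc).mem hz⟩, rfl, hz, rfl⟩

theorem and (h : PDfn hc φ) (h' : PDfn hc φ') : PDfn hc fun u v => φ u v ∧ φ' u v := by
  obtain ⟨ψ, hd, hψ⟩ := h
  obtain ⟨ψ', hd', hψ'⟩ := h'
  exact ⟨_, hd.and hd', fun u v => and_congr (hψ u v) (hψ' u v)⟩

theorem not (h : PDfn hc φ) : PDfn hc fun u v => ¬ φ u v := by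
  obtain ⟨ψ, hd, hψ⟩ := h
  exact ⟨_, hd.not, fun u v => not_congr (hψ u v)⟩

theorem or (h : PDfn hc φ) (h' : PDfn hc φ') : PDfn hc fun u v => φ u v ∨ φ' u v :=
  (h.not.and h'.not).not.congr fun _ _ => by tauto

theorem imp (h : PDfn hc φ) (h' : PDfn hc φ') : PDfn hc fun u v => φ u v → φ' u v :=
  (h.and h'.not).not.congr fun _ _ => by tauto

theorem forall_finite [Finite γ] {φ : γ → (α → P) → (β → H κ) → Prop}
    (h : ∀ g, PDfn hc (φ g)) : PDfn hc fun u v => ∀ g, φ g u v := by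
  choose ψ hd hψ using h
  exact ⟨_, Dfn.forall_finite hd, fun u v => forall_congr' fun g => hψ g u v⟩

/-- Separating the last variable of a definable relation. -/
theorem exists_exH_dfn {φ : (α → P) → (β → H κ) → H κ → Prop}
    (h : PDfn hc fun (u : α → P) (v : β ⊕ Unit → H κ) =>
      φ u (fun b => v (.inl b)) (v (.inr ()))) :
    ∃ ψ : (α ⊕ (β ⊕ Unit) → H κ) → H κ → Prop,
      (Dfn fun w : (α ⊕ (β ⊕ Unit)) ⊕ Unit → H κ => ψ (fun i => w (.inl i)) (w (.inr ()))) ∧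
      ∀ u v x, ψ (assign hc u v) x ↔ φ u v x := by
  obtain ⟨ψ, hd, hψ⟩ := h
  let g : α ⊕ ((β ⊕ Unit) ⊕ Unit) → (α ⊕ (β ⊕ Unit)) ⊕ Unit :=
    Sum.elim (fun a => .inl (.inl a)) (Sum.elim (Sum.elim (fun b => .inl (.inr (.inl b)))
      fun _ => .inr ()) fun _ => .inl (.inr (.inr ())))
  refine ⟨fun w x => ψ fun i => Sum.elim w (fun _ => x) (g i),
    (hd.relabel g).congr fun w => ?_, fun u v x => ?_⟩
  · have : (fun i => w (g i)) = fun i =>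
        Sum.elim (fun a => w (.inl a)) (fun _ => w (.inr ())) (g i) := by
      funext i
      rcases i with i | (i | i) | i <;> rfl
    rw [this]
  · have : (fun i => Sum.elim (assign hc u v) (fun _ => x) (g i)) =
        assign hc u (Sum.elim v fun _ => x) := by
      funext i
      rcases i with i | (i | i) | i <;> rfl
    beta_reduce
    rw [this]
    exact hψ u (Sum.elim v fun _ => x)

theorem exH {φ : (α → P) → (β → H κ) → H κ → Prop}
    (h : PDfn hc fun (u : α → P) (v : β ⊕ Unit → H κ) =>
      φ u (fun b => v (.inl b)) (v (.inr ()))) : PDfn hc fun u v => ∃ x, φ u v x := by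
  obtain ⟨ψ, hd, hψ⟩ := exists_exH_dfn h
  exact ⟨_, hd.ex, fun u v => exists_congr fun x => hψ u v x⟩

theorem allH {φ : (α → P) → (β → H κ) → H κ → Prop}
    (h : PDfn hc fun (u : α → P) (v : β ⊕ Unit → H κ) =>
      φ u (fun b => v (.inl b)) (v (.inr ()))) : PDfn hc fun u v => ∀ x, φ u v x :=
  (exH (φ := fun u v x => ¬ φ u v x) h.not).not.congr fun _ _ => by simp

theorem isCode_dfn (a g : α) : Dfn fun w : α → H κ => ∃ A L : H κ,
    (w a).1 = ZFSet.pair A.1 L.1 ∧ (w g).1 ∈ A.1 :=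
  .ex (.ex ((Dfn.pair _ _ _).and (Dfn.mem _ _)))

theorem isCode_iff (hc : InH κ c.poset) (x : H κ) :
    (∃ A L : H κ, c.poset = ZFSet.pair A.1 L.1 ∧ x.1 ∈ A.1) ↔ ∃ p, c.codeH hc p = x := by
  constructor
  · rintro ⟨A, L, h, hx⟩
    obtain ⟨hA, -⟩ := ZFSet.pair_inj.1 h
    rw [← hA] at hx
    exact ((c.mem_carrier _).1 hx).imp fun p hp => Subtype.ext hp
  · rintro ⟨p, rfl⟩
    exact ⟨⟨_, c.inH_carrier hc⟩, ⟨_, c.inH_rel hc⟩, rfl, (c.mem_carrier _).2 ⟨p, rfl⟩⟩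

/-- Separating the last variables for conditions of a definable relation. -/
theorem exists_exs_dfn [Finite γ] {φ : (α → P) → (β → H κ) → (γ → P) → Prop}
    (h : PDfn hc fun (u : α ⊕ γ → P) (v : β → H κ) =>
      φ (fun a => u (.inl a)) v fun g => u (.inr g)) :
    ∃ ψ : (α ⊕ (β ⊕ Unit) → H κ) → (γ → H κ) → Prop,
      (Dfn fun w : (α ⊕ (β ⊕ Unit)) ⊕ γ → H κ => ψ (fun i => w (.inl i)) fun g => w (.inr g)) ∧
      ∀ u v x, ψ (assign hc u v) x ↔ ∃ y : γ → P, (fun g => c.codeH hc (y g)) = x ∧ φ u v y := by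
  obtain ⟨ψ, hd, hψ⟩ := h
  let g : (α ⊕ γ) ⊕ (β ⊕ Unit) → (α ⊕ (β ⊕ Unit)) ⊕ γ :=
    Sum.elim (Sum.elim (fun a => .inl (.inl a)) fun i => .inr i) fun i => .inl (.inr i)
  refine ⟨fun w x => (∀ i, ∃ A L : H κ, (w (.inr (.inr ()))).1 = ZFSet.pair A.1 L.1 ∧
    (x i).1 ∈ A.1) ∧ ψ fun i => Sum.elim w x (g i),
    (Dfn.forall_finite fun i => isCode_dfn _ _).and ((hd.relabel g).congr fun w => ?_),
    fun u v x => ?_⟩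
  · have : (fun i => w (g i)) = fun i =>
        Sum.elim (fun a => w (.inl a)) (fun i => w (.inr i)) (g i) := by
      funext i
      rcases i with (i | i) | i <;> rfl
    rw [this]
  · have key : ∀ y : γ → P, (fun i => Sum.elim (assign hc u v) (fun g => c.codeH hc (y g)) (g i)) =
        assign hc (Sum.elim u y) v := by
      intro y
      funext i
      rcases i with (i | i) | i <;> rfl
    constructor
    · rintro ⟨hx, hx'⟩
      choose y hy using fun i => (isCode_iff hc (x i)).1 (hx i)
      obtain rfl : (fun g => c.codeH hc (y g)) = x := funext hy
      rw [key, hψ] at hx'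
      exact ⟨y, rfl, hx'⟩
    · rintro ⟨y, rfl, hy⟩
      refine ⟨fun i => (isCode_iff hc _).2 ⟨y i, rfl⟩, ?_⟩
      rw [key, hψ]
      exact hy

theorem exs [Finite γ] {φ : (α → P) → (β → H κ) → (γ → P) → Prop}
    (h : PDfn hc fun (u : α ⊕ γ → P) (v : β → H κ) =>
      φ (fun a => u (.inl a)) v fun g => u (.inr g)) : PDfn hc fun u v => ∃ y, φ u v y := by
  obtain ⟨ψ, hd, hψ⟩ := exists_exs_dfn h
  refine ⟨_, hd.exs, fun u v => ?_⟩
  simp only [hψ]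
  exact ⟨fun ⟨_, y, _, hy⟩ => ⟨y, hy⟩, fun ⟨y, hy⟩ => ⟨_, y, rfl, hy⟩⟩

theorem ex {φ : (α → P) → (β → H κ) → P → Prop}
    (h : PDfn hc fun (u : α ⊕ Unit → P) (v : β → H κ) =>
      φ (fun a => u (.inl a)) v (u (.inr ()))) : PDfn hc fun u v => ∃ y, φ u v y :=
  (exs (γ := Unit) (φ := fun u v y => φ u v (y ())) h).congr fun _ _ =>
    ⟨fun ⟨x, hx⟩ => ⟨x (), hx⟩, fun ⟨x, hx⟩ => ⟨fun _ => x, hx⟩⟩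

theorem all {φ : (α → P) → (β → H κ) → P → Prop}
    (h : PDfn hc fun (u : α ⊕ Unit → P) (v : β → H κ) =>
      φ (fun a => u (.inl a)) v (u (.inr ()))) : PDfn hc fun u v => ∀ y, φ u v y :=
  (ex (φ := fun u v y => ¬ φ u v y) h.not).not.congr fun _ _ => by simp

theorem compat (a b : α) : PDfn hc fun (u : α → P) (_ : β → H κ) => Compat (u a) (u b) :=
  .ex ((PDfn.le _ _).and (PDfn.le _ _))

end PDfn

/-- The elementary submodel `N` contains the forcing. -/
structure IsModelOf (c : SetCoding P) (κ : Cardinal.{0}) (N : ZFSet.{0}) : Prop where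
  elementary : IsCountableElementary κ N
  poset_mem : c.poset ∈ N

namespace IsModelOf

variable {N : ZFSet.{0}}

theorem inH (h : IsModelOf c κ N) {x : ZFSet.{0}} (hx : x ∈ N) : InH κ x := by
  obtain ⟨-, S, hS⟩ := h.elementary
  obtain ⟨y, -, rfl⟩ := (hS x).1 hx
  exact y.2

theorem exists_assign_mem (hN : IsModelOf c κ N) {u : α → P} {v : β → H κ}
    (hu : ∀ a, c.code (u a) ∈ N) (hv : ∀ b, (v b).1 ∈ N) :
    ∃ S : setLang.ElementarySubstructure (H κ), (∀ x, x ∈ S ↔ x.1 ∈ N) ∧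
      ∀ i, assign (hN.inH hN.poset_mem) u v i ∈ S := by
  obtain ⟨-, S, hS⟩ := hN.elementary
  have hS' : ∀ x : H κ, x ∈ S ↔ x.1 ∈ N := fun x => by
    rw [hS]
    exact ⟨fun hx => ⟨x, hx, rfl⟩, fun ⟨y, hy, hyx⟩ => Subtype.ext hyx ▸ hy⟩
  refine ⟨S, hS', ?_⟩
  rintro (i | i | i)
  exacts [(hS' _).2 (hu i), (hS' _).2 (hv i), (hS' _).2 hN.poset_mem]

/-- Existential statements about conditions reflect to elementary submodels. -/
theorem exists_code_mem (hN : IsModelOf c κ N) [Finite γ]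
    {φ : (α → P) → (β → H κ) → (γ → P) → Prop}
    (h : PDfn (hN.inH hN.poset_mem) fun (u : α ⊕ γ → P) (v : β → H κ) =>
      φ (fun a => u (.inl a)) v fun g => u (.inr g)) {u : α → P} {v : β → H κ}
    (hu : ∀ a, c.code (u a) ∈ N) (hv : ∀ b, (v b).1 ∈ N) (hex : ∃ y, φ u v y) :
    ∃ y, (∀ g, c.code (y g) ∈ N) ∧ φ u v y := by
  obtain ⟨S, hS, hS'⟩ := hN.exists_assign_mem hu hv
  obtain ⟨ψ, hd, hψ⟩ := PDfn.exists_exs_dfn h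
  obtain ⟨x, hx, hx'⟩ := hd.exists_mem S hS' (hex.imp' _ fun y hy => (hψ u v _).2 ⟨y, rfl, hy⟩)
  obtain ⟨y, rfl, hy⟩ := (hψ u v x).1 hx'
  exact ⟨y, fun g => (hS _).1 (hx g), hy⟩

/-- Existential statements about sets reflect to elementary submodels. -/
theorem exists_mem (hN : IsModelOf c κ N) {φ : (α → P) → (β → H κ) → H κ → Prop}
    (h : PDfn (hN.inH hN.poset_mem) fun (u : α → P) (v : β ⊕ Unit → H κ) =>
      φ u (fun b => v (.inl b)) (v (.inr ()))) {u : α → P} {v : β → H κ}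
    (hu : ∀ a, c.code (u a) ∈ N) (hv : ∀ b, (v b).1 ∈ N) (hex : ∃ y, φ u v y) :
    ∃ y : H κ, y.1 ∈ N ∧ φ u v y := by
  obtain ⟨S, hS, hS'⟩ := hN.exists_assign_mem hu hv
  obtain ⟨ψ, hd, hψ⟩ := PDfn.exists_exH_dfn h
  obtain ⟨y, hy⟩ := hex
  obtain ⟨x, hx, hx'⟩ := Dfn.exists_mem (γ := Unit) (φ := fun w x => ψ w (x ())) hd S hS'
    ⟨fun _ => y, (hψ u v y).2 hy⟩
  exact ⟨x (), (hS _).1 (hx ()), (hψ u v _).1 hx'⟩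

end IsModelOf

end ForcingDefinability
end CccForcing

/-! ### Abstract fusion orders and generic conditions. -/

namespace CccForcing

/-- Relations `R n` (`n < ω`) refining the order of a forcing, which admit fusion, and for which
every dense set can be met predensely by a finite set. Below `p`, the relation `R n` is decided by
compatibility with finitely many covers of `p`. -/
structure FusionOrder (P : Type) [Preorder P] (R : ℕ → P → P → Prop) : Prop where
  refl : ∀ n p, R n p p
  le : ∀ {n q p}, R n q p → q ≤ p
  trans : ∀ {n r q p}, R n r q → R n q p → R n r p
  exists_test : ∀ p n, ∃ (ι : Type) (_ : Finite ι) (w : ι → P), (∀ j, w j ⋖ p) ∧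
    ∀ q ≤ p, R n q p ↔ ∀ j, Compat q (w j)
  countable_covers : ∀ p : P, {w | w ⋖ p}.Countable
  exists_predense : ∀ p n, ∃ B : ℕ, ∀ D : Set P, (∀ q, ∃ d ≤ q, d ∈ D) → ∃ q, R n q p ∧
    ∃ E : Finset P, E.card ≤ B ∧ ↑E ⊆ D ∧ ∀ r ≤ q, ∃ e ∈ E, Compat e r
  exists_fusion : ∀ (X : ℕ → P → Prop) (p₀ : P), X 0 p₀ →
    (∀ k p n, X k p → ∃ q, R n q p ∧ X (k + 1) q) → ∀ n,
      ∃ q, R n q p₀ ∧ ∀ k, ∃ p, X k p ∧ q ≤ p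

section

variable {P : Type} [Preorder P] {c : SetCoding P} {κ : Cardinal.{0}}

theorem IsGenericFor.mono {N : ZFSet.{0}} {p q : P} (h : IsGenericFor c N p) (hq : q ≤ p) :
    IsGenericFor c N q :=
  fun D hD hDc hDd r hr => h D hD hDc hDd r (hr.trans hq)

/-! ### Covers belong to the model -/

/-- `z` is the ordered pair of `z'` and the code of `w`. -/
def IsStep (c : SetCoding P) (z' z : H κ) (w : P) : Prop :=
  ∃ y : H κ, c.code w = y.1 ∧ z.1 = ZFSet.pair z'.1 y.1

theorem isStep_iff (hc : InH κ c.poset) {z' z : H κ} {w : P} :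
    IsStep c z' z w ↔ z.1 = ZFSet.pair z'.1 (c.code w) :=
  ⟨fun ⟨_, h, h'⟩ => h ▸ h', fun h => ⟨c.codeH hc w, rfl, h⟩⟩

/-- `f` enumerates the covers of `p`: it consists of sets `z₀ = ∅`, `z₁ = ⟨z₀, w₀⟩`,
`z₂ = ⟨z₁, w₁⟩` and so on, where every cover of `p` is among the `wₙ`. -/
def IsCoverEnum (c : SetCoding P) (f : H κ) (p : P) : Prop :=
  (∀ z : H κ, z.1 ∈ f.1 → (∀ y : H κ, ¬ y.1 ∈ z.1) ∨ ∃ z' : H κ, z'.1 ∈ f.1 ∧ ∃ w, IsStep c z' z w) ∧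
  (∀ z₁ z₂ z' : H κ, z₁.1 ∈ f.1 → z₂.1 ∈ f.1 → (∃ w, IsStep c z' z₁ w) → (∃ w, IsStep c z' z₂ w) →
    z₁ = z₂) ∧
  ∀ w : P, ((w ≤ p ∧ ¬ p ≤ w) ∧ ∀ v : P, (w ≤ v ∧ ¬ v ≤ w) → ¬ (v ≤ p ∧ ¬ p ≤ v)) →
    ∃ z z' : H κ, z.1 ∈ f.1 ∧ z'.1 ∈ f.1 ∧ IsStep c z' z w

theorem PDfn.isStep {α β : Type} {hc : InH κ c.poset} (a b : β) (d : α) :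
    PDfn hc fun (u : α → P) (v : β → H κ) => IsStep c (v a) (v b) (u d) :=
  .exH ((PDfn.code_eq _ _).and (PDfn.pair _ _ _))

theorem PDfn.isCoverEnum {α β : Type} {hc : InH κ c.poset} (a : β) (d : α) :
    PDfn hc fun (u : α → P) (v : β → H κ) => IsCoverEnum c (v a) (u d) := by
  refine .and (.allH (.imp (.mem _ _) (.or (.allH (.not (.mem _ _)))
    (.exH (.and (.mem _ _) (.ex (.isStep _ _ _))))))) (.and ?_ ?_)
  · exact .allH (.allH (.allH (.imp (.mem _ _) (.imp (.mem _ _) (.imp (.ex (.isStep _ _ _))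
      (.imp (.ex (.isStep _ _ _)) (.eq _ _)))))))
  · exact .all (.imp (.and (.and (.le _ _) (.not (.le _ _)))
      (.all (.imp (.and (.le _ _) (.not (.le _ _))) (.not (.and (.le _ _) (.not (.le _ _)))))))
      (.exH (.exH (.and (.mem _ _) (.and (.mem _ _) (.isStep _ _ _))))))

theorem rank_lt_rank_pair (x y : ZFSet.{0}) : x.rank < (ZFSet.pair x y).rank :=
  (ZFSet.rank_lt_of_mem (ZFSet.mem_singleton.2 rfl)).trans
    (ZFSet.rank_lt_of_mem (ZFSet.mem_pair.2 (.inl rfl)))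

/-- The sequence `z₀ = ∅`, `zₙ₊₁ = ⟨zₙ, code (e n)⟩`. -/
noncomputable def nestedPairs (c : SetCoding P) (e : ℕ → P) (n : ℕ) : ZFSet.{0} :=
  n.rec ∅ fun n z => ZFSet.pair z (c.code (e n))

theorem nestedPairs_injective (c : SetCoding P) (e : ℕ → P) :
    Function.Injective (nestedPairs c e) := by
  have : StrictMono fun n => (nestedPairs c e n).rank :=
    strictMono_nat_of_lt_succ fun n => rank_lt_rank_pair _ _
  exact Function.Injective.of_comp (f := ZFSet.rank) this.injective

/-- Ranks increase along the nested pairs, so the sequence is injective and each term has at most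
one successor. Enumerated conditions that are not covers do no harm. -/
theorem isCoverEnum_range (hc : InH κ c.poset) {p : P} {e : ℕ → P} (he : {w | w ⋖ p} ⊆ range e)
    (hf : InH κ (ZFSet.range (nestedPairs c e))) :
    IsCoverEnum c (⟨_, hf⟩ : H κ) p := by
  have hmem : ∀ n, nestedPairs c e n ∈ ZFSet.range (nestedPairs c e) := fun n =>
    ZFSet.mem_range_self n
  refine ⟨?_, ?_, ?_⟩
  · intro z hz
    obtain ⟨n, hn⟩ := ZFSet.mem_range.1 hz
    cases n with
    | zero =>
      left
      intro y hy
      rw [← hn] at hy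
      exact ZFSet.notMem_empty _ hy
    | succ n => exact .inr ⟨⟨_, hf.mem (hmem n)⟩, hmem n, e n, (isStep_iff hc).2 hn.symm⟩
  · rintro z₁ z₂ z' h₁ h₂ ⟨w₁, hw₁⟩ ⟨w₂, hw₂⟩
    rw [isStep_iff hc] at hw₁ hw₂
    have key : ∀ z w, z ∈ ZFSet.range (nestedPairs c e) → z = ZFSet.pair z'.1 (c.code w) →
        ∃ n, nestedPairs c e n = z'.1 ∧ z = nestedPairs c e (n + 1) := by
      intro z w hz hzw
      obtain ⟨n, rfl⟩ := ZFSet.mem_range.1 hz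
      cases n with
      | zero =>
        have h0 : {z'.1} ∈ nestedPairs c e 0 := hzw ▸ ZFSet.mem_pair.2 (.inl rfl)
        exact absurd h0 (ZFSet.notMem_empty _)
      | succ n => exact ⟨n, (ZFSet.pair_inj.1 hzw).1, rfl⟩
    obtain ⟨n, hn, hn'⟩ := key _ _ h₁ hw₁
    obtain ⟨m, hm, hm'⟩ := key _ _ h₂ hw₂
    obtain rfl := nestedPairs_injective c e (hn.trans hm.symm)
    exact Subtype.ext (hn'.trans hm'.symm)
  · rintro w ⟨h1, h2⟩
    obtain ⟨n, rfl⟩ := he (show w ⋖ p from ⟨lt_iff_le_not_ge.2 h1, fun v hv hv' =>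
      h2 v (lt_iff_le_not_ge.1 hv) (lt_iff_le_not_ge.1 hv')⟩)
    exact ⟨⟨_, hf.mem (hmem (n + 1))⟩, ⟨_, hf.mem (hmem n)⟩, hmem (n + 1), hmem n,
      (isStep_iff hc).2 rfl⟩

/-- A family of sets belongs to `H(κ)` for all large `κ`. -/
theorem exists_inH {ι : Type} (f : ι → ZFSet.{0}) :
    ∃ κ₀ : Cardinal.{0}, ∀ κ, κ₀ ≤ κ → ∀ i, InH κ (f i) := by
  refine ⟨Order.succ (ZFSet.vonNeumann (ZFSet.range f).rank).card, fun κ hκ i =>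
    ⟨_, ZFSet.isTransitive_vonNeumann _, ?_, (Order.lt_succ _).trans_le hκ⟩⟩
  exact ZFSet.subset_vonNeumann.2 (ZFSet.rank_lt_of_mem (ZFSet.mem_range_self i)).le

namespace IsModelOf

variable {N : ZFSet.{0}}

/-- By induction on rank every element of `f` lies in `N`: it is empty, or it is the only element of
`f` whose first component is a given earlier `z'`, hence definable from `f` and `z'`. Nesting pairs
avoids having to define `ω` in the model. -/
theorem code_mem_of_isCoverEnum (hN : IsModelOf c κ N) {p w : P} {f : H κ} (hf : f.1 ∈ N)
    (h : IsCoverEnum c f p) (hw : w ⋖ p) : c.code w ∈ N := by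
  have hall : ∀ z : ZFSet.{0}, z ∈ f.1 → z ∈ N := by
    intro z
    induction hr : z.rank using WellFoundedLT.induction generalizing z with
    | ind r ih =>
      subst hr
      intro hz
      have hzH := f.2.mem hz
      rcases h.1 ⟨z, hzH⟩ hz with h0 | ⟨z', hz', w, hw⟩
      · obtain ⟨y, hyN, hy⟩ := hN.exists_mem (α := Empty) (β := Empty)
          (φ := fun _ _ x => ∀ y : H κ, ¬ y.1 ∈ x.1) (.allH (.not (.mem _ _))) (u := Empty.elim)
          (v := Empty.elim) (by simp) (by simp) ⟨_, h0⟩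
        have : y.1 = z := by
          ext t
          exact ⟨fun ht => absurd ht (hy ⟨t, y.2.mem ht⟩), fun ht => absurd ht (h0 ⟨t, hzH.mem ht⟩)⟩
        exact this ▸ hyN
      · have hzz' := (isStep_iff (hN.inH hN.poset_mem)).1 hw
        have hz'N : z'.1 ∈ N := ih _ (by
          change z = _ at hzz'
          rw [hzz']
          exact rank_lt_rank_pair _ _) z'.1 rfl hz'
        obtain ⟨y, hyN, hyf, hy⟩ := hN.exists_mem (α := Empty) (β := Bool)
          (φ := fun _ v x => x.1 ∈ (v true).1 ∧ ∃ w, IsStep c (v false) x w)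
          (.and (.mem _ _) (.ex (.isStep _ _ _))) (u := Empty.elim)
          (v := fun b => cond b f z') (by simp) (by simp [hf, hz'N]) ⟨⟨z, hzH⟩, hz, w, hw⟩
        have := h.2.1 y ⟨z, hzH⟩ z' hyf hz hy ⟨w, hw⟩
        rwa [this] at hyN
  obtain ⟨z, z', hz, hz', hstep⟩ := h.2.2 w ⟨lt_iff_le_not_ge.1 hw.1, fun v hv hv' =>
    hw.2 (lt_iff_le_not_ge.2 hv) (lt_iff_le_not_ge.2 hv')⟩
  obtain ⟨y, hy, z'', hy'⟩ := hN.exists_code_mem (α := Empty) (β := Unit) (γ := Unit)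
    (φ := fun _ v y => ∃ z' : H κ, IsStep c z' (v ()) (y ())) (.exH (.isStep _ _ _))
    (u := Empty.elim) (v := fun _ => z) (by simp) (fun _ => hall _ hz) ⟨fun _ => w, z', hstep⟩
  have hc := hN.inH hN.poset_mem
  have := ZFSet.pair_inj.1 (((isStep_iff hc).1 hstep).symm.trans ((isStep_iff hc).1 hy'))
  exact this.2 ▸ hy ()

theorem code_mem_of_covBy (hN : IsModelOf c κ N) {p w : P}
    (hex : ∃ f : H κ, IsCoverEnum c f p) (hp : c.code p ∈ N) (hw : w ⋖ p) : c.code w ∈ N := by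
  obtain ⟨f, hf, hf'⟩ := hN.exists_mem (α := Unit) (β := Empty)
    (φ := fun u _ x => IsCoverEnum c x (u ())) (.isCoverEnum _ _) (u := fun _ => p)
    (v := Empty.elim) (fun _ => hp) (by simp) hex
  exact hN.code_mem_of_isCoverEnum hf hf' hw

variable {R : ℕ → P → P → Prop}

/-- `R n` need not be definable from the forcing, so it is replaced by compatibility with the test
covers, finitely many parameters in `N`. The finite predense set is reflected as a tuple of fixed
length. -/
theorem exists_predense (hN : IsModelOf c κ N) (hR : FusionOrder P R)
    (hcov : ∀ p : P, ∃ f : H κ, IsCoverEnum c f p) {p : P} (hp : c.code p ∈ N) (n : ℕ)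
    {D : ZFSet.{0}} (hD : D ∈ N) (hDd : ∀ p, ∃ d ≤ p, c.code d ∈ D) :
    ∃ q, R n q p ∧ c.code q ∈ N ∧ ∀ r ≤ q, ∃ d, c.code d ∈ D ∧ c.code d ∈ N ∧ Compat d r := by
  obtain ⟨ι, _, w, hw, htest⟩ := hR.exists_test p n
  obtain ⟨B, hB⟩ := hR.exists_predense p n
  obtain ⟨q₀, hq₀, E, -, hED, hE⟩ := hB {d | c.code d ∈ D} hDd
  obtain ⟨y, hy, h1, h2, h3, h4⟩ := hN.exists_code_mem (α := Unit ⊕ ι) (β := Unit) (γ := Unit ⊕ E)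
    (φ := fun u v y => y (.inl ()) ≤ u (.inl ()) ∧ (∀ j, Compat (y (.inl ())) (u (.inr j))) ∧
      (∀ e, c.code (y (.inr e)) ∈ (v ()).1) ∧ ∀ r, r ≤ y (.inl ()) → ¬ ∀ e, ¬ Compat (y (.inr e)) r)
    (.and (.le _ _) (.and (.forall_finite fun _ => .compat _ _)
      (.and (.forall_finite fun _ => .code_mem _ _)
        (.all (.imp (.le _ _) (.not (.forall_finite fun _ => .not (.compat _ _))))))))
    (u := Sum.elim (fun _ => p) w) (v := fun _ => ⟨D, hN.inH hD⟩)
    (by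
      rintro (a | a)
      exacts [hp, hN.code_mem_of_covBy (hcov p) hp (hw a)])
    (fun _ => hD)
    ⟨Sum.elim (fun _ => q₀) Subtype.val, hR.le hq₀, (htest q₀ (hR.le hq₀)).1 hq₀,
      fun e => hED e.2, fun r hr hno => by
        obtain ⟨e, he, her⟩ := hE r hr
        exact hno ⟨e, he⟩ her⟩
  refine ⟨y (.inl ()), (htest _ h1).2 h2, hy _, fun r hr => ?_⟩
  obtain ⟨e, he⟩ := not_forall_not.1 (h4 r hr)
  exact ⟨_, h3 e, hy _, he⟩

/-- Genericity of `q` for `x` as a property over `H(κ)`. -/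
def GenericIn (c : SetCoding P) (x : H κ) (q : P) : Prop :=
  ∀ D : H κ, D.1 ∈ x.1 → (∀ y : H κ, y.1 ∈ D.1 → ∃ p, c.code p = y.1) →
    (∀ p, ∃ d, d ≤ p ∧ c.code d ∈ D.1) →
      ∀ r, r ≤ q → ∃ d, c.code d ∈ D.1 ∧ c.code d ∈ x.1 ∧ Compat d r

theorem genericIn_iff {x : H κ} {q : P} : GenericIn c x q ↔ IsGenericFor c x.1 q := by
  constructor
  · intro h D hD hDc hDd r hr
    exact h ⟨D, x.2.mem hD⟩ hD (fun y hy => (c.mem_carrier _).1 (hDc hy)) hDd r hr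
  · intro h D hD hDc hDd r hr
    exact h D.1 hD (fun y hy => (c.mem_carrier _).2 (hDc ⟨y, D.2.mem hy⟩ hy)) hDd r hr

theorem genericIn_dfn {α β : Type} {hc : InH κ c.poset} (a : β) (d : α) :
    PDfn hc fun (u : α → P) (v : β → H κ) => GenericIn c (v a) (u d) :=
  .allH (.imp (.mem _ _) (.imp (.allH (.imp (.mem _ _) (.ex (.code_eq _ _))))
    (.imp (.all (.ex (.and (.le _ _) (.code_mem _ _))))
      (.all (.imp (.le _ _) (.ex (.and (.code_mem _ _) (.and (.code_mem _ _) (.compat _ _)))))))))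

/-- A condition generic for the models of a sequence in `N` may be found in `N`. -/
theorem exists_generic_seq (hN : IsModelOf c κ N) (hR : FusionOrder P R)
    (hcov : ∀ p : P, ∃ f : H κ, IsCoverEnum c f p) {p : P} (hp : c.code p ∈ N) (n : ℕ)
    {M : Ordinal.{0} → ZFSet.{0}} {γ : Ordinal.{0}} (hM : seqUpTo M γ ∈ N)
    (hex : ∃ q, R n q p ∧ ∀ ξ ≤ γ, IsGenericFor c (M ξ) q) :
    ∃ q, R n q p ∧ c.code q ∈ N ∧ ∀ ξ ≤ γ, IsGenericFor c (M ξ) q := by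
  obtain ⟨ι, _, w, hw, htest⟩ := hR.exists_test p n
  obtain ⟨q₀, hq₀, hq₀'⟩ := hex
  have hmem : ∀ ξ ≤ γ, ZFSet.pair ξ.toZFSet (M ξ) ∈ seqUpTo M γ := fun ξ hξ =>
    ZFSet.mem_range.2 ⟨⟨ξ, hξ⟩, rfl⟩
  -- The sequence is a single parameter; the formula quantifies over the pairs in it and asks for
  -- genericity for each second component.
  obtain ⟨y, hy, h1, h2, h3⟩ := hN.exists_code_mem (α := Unit ⊕ ι) (β := Unit) (γ := Unit)
    (φ := fun u v y => y () ≤ u (.inl ()) ∧ (∀ j, Compat (y ()) (u (.inr j))) ∧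
      ∀ z ξ x : H κ, z.1 ∈ (v ()).1 → z.1 = ZFSet.pair ξ.1 x.1 → GenericIn c x (y ()))
    (.and (.le _ _) (.and (.forall_finite fun _ => .compat _ _)
      (.allH (.allH (.allH (.imp (.mem _ _) (.imp (.pair _ _ _) (genericIn_dfn _ _))))))))
    (u := Sum.elim (fun _ => p) w) (v := fun _ => ⟨_, hN.inH hM⟩)
    (by
      rintro (a | a)
      exacts [hp, hN.code_mem_of_covBy (hcov p) hp (hw a)])
    (fun _ => hM)
    ⟨fun _ => q₀, hR.le hq₀, (htest q₀ (hR.le hq₀)).1 hq₀, fun z ξ x hz hzx => by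
      obtain ⟨⟨η, hη⟩, hηz⟩ := ZFSet.mem_range.1 hz
      have := (ZFSet.pair_inj.1 (hηz.trans hzx)).2
      rw [genericIn_iff, ← this]
      exact hq₀' η hη⟩
  refine ⟨y (), (htest _ h1).2 h2, hy _, fun ξ hξ => ?_⟩
  have hz := (hN.inH hM).mem (hmem ξ hξ)
  have hz' : InH κ {ξ.toZFSet, M ξ} := hz.mem (ZFSet.mem_pair.2 (.inr rfl))
  exact genericIn_iff.1 (h3 ⟨_, hz⟩ ⟨_, hz'.mem (ZFSet.mem_pair.2 (.inl rfl))⟩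
    ⟨_, hz'.mem (ZFSet.mem_pair.2 (.inr rfl))⟩ (hmem ξ hξ) rfl)

/-- All stages of the fusion stay in the countable model, the `k`-th step handling its `k`-th
element; only the limit may leave the model. -/
theorem exists_generic (hN : IsModelOf c κ N) (hR : FusionOrder P R)
    (hcov : ∀ p : P, ∃ f : H κ, IsCoverEnum c f p) {p : P} (hp : c.code p ∈ N) (n : ℕ) :
    ∃ q, R n q p ∧ IsGenericFor c N q := by
  obtain ⟨D, hD⟩ := hN.elementary.1.exists_eq_range ⟨_, hN.poset_mem⟩
  have hDN : ∀ k, D k ∈ N := fun k => by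
    have : D k ∈ (N : Set ZFSet.{0}) := hD ▸ mem_range_self k
    exact this
  obtain ⟨q, hq, hq'⟩ := hR.exists_fusion (fun k p => c.code p ∈ N ∧ ∀ j < k,
    (∀ p, ∃ d ≤ p, c.code d ∈ D j) → ∀ r ≤ p, ∃ d, c.code d ∈ D j ∧ c.code d ∈ N ∧ Compat d r) p
    ⟨hp, by simp⟩ (fun k p n ⟨hp, hpk⟩ => by
      by_cases hdense : ∀ p, ∃ d ≤ p, c.code d ∈ D k
      · obtain ⟨q, hq, hqN, hqD⟩ := hN.exists_predense hR hcov hp n (hDN k) hdense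
        refine ⟨q, hq, hqN, fun j hj hjd r hr => ?_⟩
        rcases Nat.lt_succ_iff_lt_or_eq.1 hj with h | rfl
        exacts [hpk j h hjd r (hr.trans (hR.le hq)), hqD r hr]
      · refine ⟨p, hR.refl n p, hp, fun j hj hjd r hr => ?_⟩
        rcases Nat.lt_succ_iff_lt_or_eq.1 hj with h | rfl
        exacts [hpk j h hjd r hr, absurd hjd hdense]) n
  refine ⟨q, hq, fun E hE hEc hEd r hr => ?_⟩
  obtain ⟨k, rfl⟩ : E ∈ range D := hD ▸ hE
  obtain ⟨p', ⟨-, hp'⟩, hqp'⟩ := hq' (k + 1)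
  exact hp' k k.lt_succ_self hEd r (hr.trans hqp')

end IsModelOf

/-! ### `α`-properness from fusion -/

theorem countable_Iio_of_lt_omega_one {γ : Ordinal.{0}} (h : γ < Ordinal.omega 1) :
    (Iio γ).Countable := by
  rw [← Cardinal.le_aleph0_iff_set_countable, Cardinal.mk_Iio_ordinal, Cardinal.lift_le_aleph0,
    ← Order.lt_succ_iff, Cardinal.succ_aleph0, ← Cardinal.lt_ord, Cardinal.ord_aleph]
  exact h

variable {R : ℕ → P → P → Prop}

/-- The induction is on `γ`, for all starting models `N δ`, all `p` already generic below `δ`, and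
all `n`. Limit stages need this generality, since they resume from intermediate models under a
prescribed `R n`. -/
theorem IsModelChain.exists_generic (hR : FusionOrder P R)
    (hcov : ∀ p : P, ∃ f : H κ, IsCoverEnum c f p) {α : Ordinal.{0}} (hα : α < Ordinal.omega 1)
    {N : Ordinal.{0} → ZFSet.{0}} (hN : IsModelChain κ α N) (h0 : c.poset ∈ N 0)
    {γ : Ordinal.{0}} (hγ : γ ≤ α) {δ : Ordinal.{0}} (hδ : δ ≤ γ) {p : P} (hp : c.code p ∈ N δ)
    (hpg : ∀ ξ < δ, IsGenericFor c (N ξ) p) (n : ℕ) :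
    ∃ q, R n q p ∧ ∀ ξ ≤ γ, IsGenericFor c (N ξ) q := by
  have hmod : ∀ ξ ≤ α, IsModelOf c κ (N ξ) := fun ξ hξ =>
    ⟨hN.elementary ξ hξ, hN.mono 0 ξ zero_le hξ h0⟩
  induction γ using WellFoundedLT.induction generalizing δ p n with
  | ind γ ih =>
    have hlast : ∀ p, c.code p ∈ N γ → (∀ ξ < γ, IsGenericFor c (N ξ) p) → ∀ n,
        ∃ q, R n q p ∧ ∀ ξ ≤ γ, IsGenericFor c (N ξ) q := by
      intro p hp hpg n
      obtain ⟨q, hq, hqg⟩ := (hmod γ hγ).exists_generic hR hcov hp n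
      refine ⟨q, hq, fun ξ hξ => ?_⟩
      rcases hξ.lt_or_eq with h | rfl
      exacts [(hpg ξ h).mono (hR.le hq), hqg]
    -- The induction hypothesis gives a condition generic up to `η`; as the sequence up to `η`
    -- belongs to the next model, such a condition exists there too.
    have hnext : ∀ η < γ, ∀ δ ≤ η, ∀ p, c.code p ∈ N δ → (∀ ξ < δ, IsGenericFor c (N ξ) p) → ∀ n,
        ∃ q, R n q p ∧ c.code q ∈ N (Order.succ η) ∧ ∀ ξ ≤ η, IsGenericFor c (N ξ) q := by
      intro η hη δ hδ p hp hpg n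
      have hsucc : Order.succ η ≤ α := (Order.succ_le_of_lt hη).trans hγ
      exact (hmod _ hsucc).exists_generic_seq hR hcov
        (hN.mono _ _ (hδ.trans (Order.le_succ η)) hsucc hp) n (hN.seq_mem η (hη.trans_le hγ))
        (ih η hη (hη.le.trans hγ) hδ hp hpg n)
    rcases hδ.lt_or_eq with hδγ | rfl
    swap
    · exact hlast p hp hpg n
    rcases Ordinal.zero_or_succ_or_isSuccLimit γ with rfl | ⟨η, rfl⟩ | hlim
    · exact absurd hδγ (not_lt.2 zero_le)
    · obtain ⟨q, hq, hqN, hqg⟩ := hnext η (Order.lt_succ η) δ (Order.lt_succ_iff.1 hδγ) p hp hpg n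
      obtain ⟨q', hq', hqg'⟩ := hlast q hqN (fun ξ hξ => hqg ξ (Order.lt_succ_iff.1 hξ)) n
      exact ⟨q', hR.trans hq' hq, hqg'⟩
    -- Since `γ` is countable, a fusion can absorb every index below it, always moving on to a model
    -- with successor index below `γ`.
    · obtain ⟨b, hb⟩ := (countable_Iio_of_lt_omega_one (hγ.trans_lt hα)).exists_eq_range ⟨δ, hδγ⟩
      have hbγ : ∀ k, b k < γ := fun k => by
        have : b k ∈ Iio γ := hb ▸ mem_range_self k
        exact this
      obtain ⟨q, hq, hqX⟩ := hR.exists_fusion (fun k p => ∃ δ < γ, c.code p ∈ N δ ∧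
        (∀ ξ < δ, IsGenericFor c (N ξ) p) ∧ ∀ j < k, b j < δ) p ⟨δ, hδγ, hp, hpg, by simp⟩
        (fun k p n ⟨δ, hδγ, hp, hpg, hbδ⟩ => by
          have hη : max δ (b k) < γ := max_lt hδγ (hbγ k)
          obtain ⟨q, hq, hqN, hqg⟩ := hnext _ hη δ (le_max_left _ _) p hp hpg n
          refine ⟨q, hq, _, hlim.succ_lt hη, hqN, fun ξ hξ => hqg ξ (Order.lt_succ_iff.1 hξ),
            fun j hj => Order.lt_succ_iff.2 ?_⟩
          rcases Nat.lt_succ_iff_lt_or_eq.1 hj with h | rfl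
          exacts [(hbδ j h).le.trans (le_max_left _ _), le_max_right _ _]) n
      have hqg : ∀ ξ < γ, IsGenericFor c (N ξ) q := by
        intro ξ hξ
        obtain ⟨k, rfl⟩ : ξ ∈ range b := hb ▸ hξ
        obtain ⟨p', ⟨δ', -, -, hg, hbk⟩, hqp'⟩ := hqX (k + 1)
        exact (hg _ (hbk k k.lt_succ_self)).mono hqp'
      refine ⟨q, hq, fun ξ hξ => ?_⟩
      rcases hξ.lt_or_eq with h | rfl
      · exact hqg ξ h
      -- By continuity a dense set in the limit model appears in an earlier one, so genericity at
      -- the limit is automatic.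
      · intro D hD hDc hDd r hr
        obtain ⟨η, hη, hDη⟩ := (hN.continuous ξ hγ hlim D).1 hD
        obtain ⟨d, hdD, hdN, hdr⟩ := hqg η hη D hDη hDc hDd r hr
        exact ⟨d, hdD, hN.mono η ξ hη.le hγ hdN, hdr⟩

theorem FusionOrder.alphaProper (hR : FusionOrder P R) {α : Ordinal.{0}}
    (hα : α < Ordinal.omega 1) : AlphaProper α P := by
  intro c
  have he : ∀ p : P, ∃ e : ℕ → P, {w | w ⋖ p} ⊆ range e := fun p =>
    have : Nonempty P := ⟨p⟩
    countable_iff_exists_subset_range.1 (hR.countable_covers p)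
  choose e he using he
  -- The only demand on `κ` is that `H(κ)` contain, for each condition, an enumeration of its
  -- covers.
  obtain ⟨κ₀, hκ₀⟩ := exists_inH fun p => ZFSet.range (nestedPairs c (e p))
  refine ⟨κ₀, fun κ hκ _ _ N hN h0 p hp => ?_⟩
  have hc : InH κ c.poset :=
    IsModelOf.inH ⟨hN.elementary 0 zero_le, h0⟩ h0
  obtain ⟨q, hq, hqg⟩ := hN.exists_generic hR
    (fun p => ⟨_, isCoverEnum_range hc (he p) (hκ₀ κ hκ p)⟩) hα h0 le_rfl zero_le hp
    (fun ξ hξ => absurd hξ (not_lt.2 zero_le)) 0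
  exact ⟨q, hR.le hq, hqg⟩

end
end CccForcing

/-! ### The strong PP-property from fusion. -/

namespace CccForcing

section

variable {P : Type} [Preorder P]

theorem Forces.mono {p q : P} {τ : RelName P} {n m : ℕ} (h : Forces p τ n m) (hq : q ≤ p) :
    Forces q τ n m := fun r hr => h r (hr.trans hq)

/-- `s` forces the list `σ` to be an initial segment of `τ`. -/
def ForcesSeg (s : P) (τ : RelName P) (σ : List ℕ) : Prop :=
  ∀ i (hi : i < σ.length), Forces s τ i σ[i]

theorem ForcesSeg.mono {p q : P} {τ : RelName P} {σ : List ℕ} (h : ForcesSeg p τ σ) (hq : q ≤ p) :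
    ForcesSeg q τ σ := fun i hi => (h i hi).mono hq

theorem ForcesFunction.exists_seg {p : P} {τ : RelName P} (hτ : ForcesFunction p τ) (n : ℕ) :
    ∀ r ≤ p, ∃ s ≤ r, ∃ σ : List ℕ, σ.length = n ∧ ForcesSeg s τ σ := by
  intro r hr
  induction n with
  | zero => exact ⟨r, le_rfl, [], rfl, fun i hi => absurd hi (Nat.not_lt_zero i)⟩
  | succ n ih =>
    obtain ⟨s, hs, σ, hσ, hsσ⟩ := ih
    obtain ⟨t, ht, m, hm⟩ := hτ.1 n s (hs.trans hr)
    refine ⟨t, ht.trans hs, σ ++ [m], by simp [hσ], fun i hi => ?_⟩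
    rcases lt_or_ge i σ.length with h | h
    · rw [List.getElem_append_left h]
      exact (hsσ i h).mono ht
    · have hi' : i = σ.length := by
        rw [List.length_append, List.length_singleton] at hi
        omega
      subst hi'
      simpa [hσ] using hm

/-- Two initial segments forced by the same condition are comparable. -/
theorem ForcesFunction.prefix_of_seg {p : P} {τ : RelName P} (hτ : ForcesFunction p τ) {r : P}
    (hr : r ≤ p) {σ ρ : List ℕ} (hσ : ForcesSeg r τ σ) (hρ : ForcesSeg r τ ρ)
    (hlen : σ.length ≤ ρ.length) : σ <+: ρ := by
  rw [List.prefix_iff_eq_take]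
  refine List.ext_getElem (by simpa using hlen) fun i hi hi' => ?_
  by_contra hne
  rw [List.getElem_take] at hne
  exact hτ.2 i _ _ hne r hr ⟨hσ i hi, hρ i _⟩

theorem FusionOrder.strongPP {R : ℕ → P → P → Prop} (hR : FusionOrder P R) : StrongPP P := by
  classical
  intro h hh p₀ τ hτ
  obtain ⟨q, hq, hqX⟩ := hR.exists_fusion (fun k p => p ≤ p₀ ∧ (0 < k → ∃ m ≥ k,
    ∃ E : Finset (List ℕ), E.card < h m ∧ (∀ σ ∈ E, σ.length = m) ∧
      ∀ r ≤ p, ∃ s ≤ r, ∃ σ ∈ E, ForcesSeg s τ σ)) p₀ ⟨le_rfl, by simp⟩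
    (fun k p n ⟨hp, _⟩ => by
      obtain ⟨B, hB⟩ := hR.exists_predense p n
      -- The level is chosen after the bound `B`, which does not depend on the dense set deciding
      -- the name up to `m`.
      obtain ⟨m, hmB, hmk⟩ := ((hh.eventually_gt_atTop B).and (eventually_ge_atTop (k + 1))).exists
      obtain ⟨q, hq, E, hEB, hED, hE⟩ := hB
        -- Conditions incompatible with `p` are admitted to make the set dense everywhere; they are
        -- discarded from `E` afterwards.
        {d | (∃ r, r ≤ d ∧ r ≤ p) → ∃ σ : List ℕ, σ.length = m ∧ ForcesSeg d τ σ} (fun q => by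
          by_cases hc : ∃ r, r ≤ q ∧ r ≤ p
          · obtain ⟨r, hrq, hrp⟩ := hc
            obtain ⟨s, hs, hσ⟩ := hτ.exists_seg m r (hrp.trans hp)
            exact ⟨s, hs.trans hrq, fun _ => hσ⟩
          · exact ⟨q, le_rfl, fun hc' => absurd hc' hc⟩)
      have hex : ∀ d, ∃ σ : List ℕ, (d ∈ E ∧ ∃ r, r ≤ d ∧ r ≤ p) →
          σ.length = m ∧ ForcesSeg d τ σ := fun d => by
        by_cases hd : d ∈ E ∧ ∃ r, r ≤ d ∧ r ≤ p
        · exact (hED hd.1 hd.2).imp fun _ h _ => h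
        · exact ⟨[], fun h => absurd h hd⟩
      choose f hf using hex
      refine ⟨q, hq, (hR.le hq).trans hp, fun _ => ⟨m, hmk,
        (E.filter fun d => ∃ r, r ≤ d ∧ r ≤ p).image f, ?_, ?_, fun r hr => ?_⟩⟩
      · exact (Finset.card_image_le.trans (Finset.card_filter_le _ _)).trans_lt
          (hEB.trans_lt hmB)
      · simp only [Finset.mem_image, Finset.mem_filter]
        rintro _ ⟨d, hd, rfl⟩
        exact (hf d hd).1
      · obtain ⟨d, hd, s, hsd, hsr⟩ := hE r hr
        have hd' : d ∈ E ∧ ∃ r, r ≤ d ∧ r ≤ p := ⟨hd, s, hsd, hsr.trans (hr.trans (hR.le hq))⟩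
        exact ⟨s, hsr, f d, Finset.mem_image_of_mem f (Finset.mem_filter.2 hd'),
          (hf d hd').2.mono hsd⟩) 0
  have hqp₀ : q ≤ p₀ := hR.le hq
  have hseq : ∀ k, ∃ m ≥ k, ∃ E : Finset (List ℕ), E.card < h m ∧ (∀ σ ∈ E, σ.length = m) ∧
      ∀ r ≤ q, ∃ s ≤ r, ∃ σ ∈ E, ForcesSeg s τ σ := fun k => by
    obtain ⟨p, ⟨-, hp⟩, hqp⟩ := hqX (k + 1)
    obtain ⟨m, hm, E, hE, hE', hE''⟩ := hp k.succ_pos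
    exact ⟨m, k.le_succ.trans hm, E, hE, hE', fun r hr => hE'' r (hr.trans hqp)⟩
  choose m hm E hEcard hElen hE using hseq
  -- The tree consists of the sequences comparable, for every `k`, with some member of `E k`. Its
  -- level `m k` is contained in `E k`, and level `n` is finite because members of `E n` have length
  -- at least `n`.
  refine ⟨q, hqp₀, {ρ | ∀ k, ∃ σ ∈ E k, ρ <+: σ ∨ σ <+: ρ}, ?_, fun n => ?_, fun k => ?_,
    fun n r hr => ?_⟩
  · intro σ hσ ρ hρ k
    obtain ⟨σ', hσ', h1 | h1⟩ := hσ k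
    · exact ⟨σ', hσ', .inl (hρ.trans h1)⟩
    · exact ⟨σ', hσ', List.prefix_or_prefix_of_prefix hρ h1⟩
  · refine ((E n).image fun σ => σ.take n).finite_toSet.subset fun ρ hρ => ?_
    obtain ⟨σ, hσ, h1⟩ := hρ.1 n
    have hpre : ρ <+: σ := h1.elim id fun h2 => by
      have h3 := h2.length_le
      have h4 := hElen n σ hσ
      have h5 := hm n
      have h6 : ρ.length = n := hρ.2
      rw [h2.eq_of_length (by omega)]
    rw [Finset.mem_coe, Finset.mem_image]
    refine ⟨σ, hσ, ?_⟩
    rw [List.prefix_iff_eq_take, show ρ.length = n from hρ.2] at hpre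
    exact hpre.symm
  · refine ⟨m k, hm k, lt_of_le_of_lt ?_ (hEcard k)⟩
    rw [← Set.ncard_coe_finset]
    refine Set.ncard_le_ncard (fun ρ hρ => ?_) (E k).finite_toSet
    obtain ⟨σ, hσ, h1⟩ := hρ.1 k
    have hlen : ρ.length = σ.length := hρ.2.trans (hElen k σ hσ).symm
    have : ρ = σ := h1.elim (fun h => h.eq_of_length hlen) fun h => (h.eq_of_length hlen.symm).symm
    exact this ▸ hσ
  · obtain ⟨s, hs, σ, hσ, hsσ⟩ := hτ.exists_seg n r (hr.trans hqp₀)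
    refine ⟨s, hs, σ, fun k => ?_, hσ, hsσ⟩
    obtain ⟨t, ht, ρ, hρ, htρ⟩ := hE k s (hs.trans hr)
    have htp := ht.trans (hs.trans (hr.trans hqp₀))
    exact ⟨ρ, hρ, (le_total σ.length ρ.length).imp
      (hτ.prefix_of_seg htp (hsσ.mono ht) htρ) (hτ.prefix_of_seg htp htρ (hsσ.mono ht))⟩

end

theorem QForcing.fusionOrder {F : Filter ℕ} {T₀ : NatTree} (hF : IsCccPFilter F)
    (hT : T₀.IsFullBinary) : FusionOrder (QForcing F T₀) QForcing.LeAt where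
  refl _ _ := ⟨le_rfl, fun _ _ _ _ h => h⟩
  le h := h.1
  trans h h' := h.trans h'
  exists_test := exists_test hF.le_cofinite hT
  countable_covers := countable_covers hT
  exists_predense := exists_predense hF.le_cofinite hT
  exists_fusion X p₀ h0 hstep n := exists_fusion hF hT X p₀ h0 hstep n

end CccForcing

theorem mainTheorem2 (F : Filter ℕ) (hF : CccForcing.IsCccPFilter F) :
    (∃ T₀ : CccForcing.NatTree, CccForcing.IsBaseTree F T₀) ∧
    ∀ T₀ : CccForcing.NatTree, CccForcing.IsBaseTree F T₀ →
      (∀ α : Ordinal.{0}, α < Ordinal.omega 1 →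
        CccForcing.AlphaProper α (CccForcing.QForcing F T₀)) ∧
      CccForcing.StrongPP (CccForcing.QForcing F T₀) :=
  ⟨hF.exists_baseTree, fun _ hT₀ =>
    ⟨fun _ hα => (CccForcing.QForcing.fusionOrder hF hT₀.2).alphaProper hα,
      (CccForcing.QForcing.fusionOrder hF hT₀.2).strongPP⟩⟩
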